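/- **Setting.** Let $d\ge1$, $\mathbb R_+=[0,\infty)$ and $\mathbb T^d=[-\pi,\pi]^d$. Let $a:\mathbb R_+\to\mathbb R$ satisfy $a_0\le a(t)\le a_1$ with constants $a_0,a_1>0$. For $u_0,u_1\in\ell^2(\mathbb Z^d)$ let $u\in C^2(\mathbb R_+;\ell^2(\mathbb Z^d))$ be the solution of $$u''(t)[k]-a(t)^2\sum_{j=1}^d D_j^+D_j^-u(t)[k]=0\quad(t\ge0,\ k\in\mathbb Z^d),\qquad u(0)=u_0,\ u'(0)=u_1,$$ where $D_j^+f[k]=f[k+e_j]-f[k]$ and $D_j^-f[k]=f[k]-f[k-e_j]$, and let $$E(t)=\sum_{k}|u'(t)[k]|^2+a(t)^2\sum_{j=1}^d\sum_k|D_j^+u(t)[k]|^2 .$$ For $f\in\ell^2(\mathbb Z^d)$ let $\hat f(\theta)=\sum_k e^{-ik\cdot\theta}f[k]$, with convergence in $L^2(\mathbb T^d)$. Put $\xi_j=\xi_j(\theta)=2\sin(\theta_j/2)$, $|\xi(\theta)|=(\sum_j\xi_j^2)^{1/2}$ and $$\mathcal E(0,\theta)=|\hat u_1(\theta)|^2+a(0)^2|\xi(\theta)|^2|\hat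 u_0(\theta)|^2 .$$ For $\nu>1$ and $\rho>0$ let $\gamma^\nu_\rho$ be the set of $f\in C^\infty(\mathbb T^d)$ with $\sup_{\theta\in\mathbb T^d,\ \alpha\in\mathbb N_0^d}|\partial^\alpha f(\theta)|\,\rho^{|\alpha|}/\alpha!^{\nu}<\infty$, and let $\gamma^\nu_\infty=\bigcup_{\rho>0}\gamma^\nu_\rho$. **Hypotheses.** Let $0\le p<q<1$, let $m\ge1$ be an integer, and put $\Xi(t)=(1+t)^{\frac pm-q+1}$ and $\Lambda(t)=(1+t)^{1-q}$. Assume that $\Xi^{-m}\in L^1(\mathbb R_+)$, i.e. $p+m(1-q)>1$. Let $\Theta$ be a positive, monotone increasing function on $\mathbb R_+$ with $\Theta(t)\lesssim(1+t)^{1-p}$. Assume that there is a constant $a_\infty>0$ with $\int_0^t|a(s)-a_\infty|\,ds\le\Theta(t)$ for all $t\ge0$, and that $a\in C^m(\mathbb R_+)$ with $|a^{(k)}(t)|\le C_k\,\Xi(t)^{-k}$ for all $t\ge 0$ and $k=1,\dots,m$, with positive constants $C_k$. For $N>0$ put $$U(N,u_0,u_1)=\int_{\mathbb T^d}\exp\Big(2|\xi(\theta)|\,\Theta\Big(\Lambda^{-1}\Big(\frac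 N{|\xi(\theta)|}\Big)\Big)\Big)\mathcal E(0,\theta)\,d\theta ,$$ where $N\ge2\sqrt d$ guarantees that $N/|\xi(\theta)|$ lies in the range of $\Lambda$ for every $\theta\ne 0$. **Conclusion.** (i) If $1<\nu<(1-p)/(q-p)$ and $\xi_j\hat u_0\in\gamma^\nu_\infty$ $(j=1,\dots,d)$, $\hat u_1\in\gamma^\nu_\infty$, with $\partial^\alpha(\xi_j\hat u_0)(0)=0$ and $\partial^\alpha\hat u_1(0)=0$ for all $j$ and all $\alpha\in\mathbb N_0^d$, then there exists $N_0\ge2\sqrt d$ such that $U(N_0,u_0,u_1)<\infty$ and $E(t)\lesssim U(N_0,u_0,u_1)$ uniformly in $t\ge0$. (ii) There exist $\rho>0$ and $N_0\ge2\sqrt d$ such that, with $\nu=(1-p)/(q-p)$, for all $u_0,u_1$ with $\xi_j\hat u_0\in\gamma^\nu_\rho$ $(j=1,\dots,d)$ and $\hat u_1\in\gamma^\nu_\rho$ whose derivatives of every order vanish at $\theta=0$ as in (i), one has $U(N_0,u_0,u_1)<\infty$ and $E(t)\lesssim U(N_0,u_0,u_1)$ uniformly in $t\ge0$. Moreover,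 if also $(1+t)^{1-p}\lesssim\Theta(t)$, then $N_0$ and the implied constant in (i) can be chosen independently of $u_0$, $u_1$ and $\nu$, and $\rho$, $N_0$ and the implied constant in (ii) can be chosen independently of $u_0$ and $u_1$. -/

import Mathlib

open Set Filter Topology MeasureTheory
open scoped ENNReal ContDiff Nat

noncomputable section

namespace SemiDiscreteWave

/-- `ℓ²(ℤᵈ)`, complex valued. -/
abbrev Ell2 (d : ℕ) : Type := lp (fun _ : Fin d → ℤ => ℂ) 2

/-- Forward difference `(D_j⁺ f)[k] = f[k + e_j] - f[k]`. -/
def Dplus {d : ℕ} (j : Fin d) (f : (Fin d → ℤ) → ℂ) : (Fin d → ℤ) → ℂ :=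
  fun k => f (k + Pi.single j 1) - f k

/-- Backward difference `(D_j⁻ f)[k] = f[k] - f[k - e_j]`. -/
def Dminus {d : ℕ} (j : Fin d) (f : (Fin d → ℤ) → ℂ) : (Fin d → ℤ) → ℂ :=
  fun k => f k - f (k - Pi.single j 1)

/-- `u`, with time derivative `u'`, is the (`C²` in time, `ℓ²`-valued) solution on `[0, ∞)` of
`u''(t)[k] - a(t)² ∑_j D_j⁺ D_j⁻ u(t)[k] = 0`, `u(0) = u₀`, `u'(0) = u₁`. -/
structure IsSolution {d : ℕ} (a : ℝ → ℝ) (u₀ u₁ : Ell2 d) (u u' : ℝ → Ell2 d) : Prop where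
  deriv_fst : ∀ t : ℝ, 0 ≤ t → HasDerivWithinAt u (u' t) (Ici 0) t
  deriv_snd : ∀ t : ℝ, 0 ≤ t → ∃ w : Ell2 d, HasDerivWithinAt u' w (Ici 0) t ∧
    ∀ k : Fin d → ℤ, w k - (a t : ℂ) ^ 2 * ∑ j : Fin d, Dplus j (Dminus j (u t)) k = 0
  init_fst : u 0 = u₀
  init_snd : u' 0 = u₁

/-- Total energy `E(t) = ∑_k |u'(t)[k]|² + a(t)² ∑_j ∑_k |D_j⁺ u(t)[k]|²`, in `[0, ∞]`. -/
def energy {d : ℕ} (a : ℝ → ℝ) (u u' : ℝ → Ell2 d) (t : ℝ) : ℝ≥0∞ :=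
  (∑' k : Fin d → ℤ, ‖u' t k‖ₑ ^ 2) +
    ENNReal.ofReal (a t ^ 2) * ∑ j : Fin d, ∑' k : Fin d → ℤ, ‖Dplus j (u t) k‖ₑ ^ 2

/-- The cube `𝕋ᵈ = [-π, π]ᵈ`. -/
def cube (d : ℕ) : Set (Fin d → ℝ) := Icc (fun _ => -Real.pi) (fun _ => Real.pi)

/-- `F` represents the discrete-time Fourier transform of `f ∈ ℓ²(ℤᵈ)`:
`F(θ) = ∑_k e^{-i k·θ} f[k]`, the series converging in `L²(𝕋ᵈ)`. -/
def IsDTFT {d : ℕ} (f : Ell2 d) (F : (Fin d → ℝ) → ℂ) : Prop :=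
  MemLp F 2 (volume.restrict (cube d)) ∧
  Tendsto (fun s : Finset (Fin d → ℤ) =>
      eLpNorm (fun θ : Fin d → ℝ =>
        ∑ k ∈ s, Complex.exp (-Complex.I * ((∑ j, (k j : ℝ) * θ j : ℝ) : ℂ)) * f k - F θ)
        2 (volume.restrict (cube d)))
    atTop (𝓝 0)

/-- `ξ_j(θ_j) = 2 sin(θ_j / 2)`. -/
def xi {d : ℕ} (j : Fin d) (θ : Fin d → ℝ) : ℝ := 2 * Real.sin (θ j / 2)

/-- The Euclidean norm `|ξ(θ)|`. -/
def xiNorm {d : ℕ} (θ : Fin d → ℝ) : ℝ := Real.sqrt (∑ j, xi j θ ^ 2)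

/-- Initial energy density `𝓔(0, θ) = |û₁(θ)|² + a(0)² |ξ(θ)|² |û₀(θ)|²`. -/
def initialDensity {d : ℕ} (a : ℝ → ℝ) (F₀ F₁ : (Fin d → ℝ) → ℂ) (θ : Fin d → ℝ) : ℝ :=
  ‖F₁ θ‖ ^ 2 + a 0 ^ 2 * xiNorm θ ^ 2 * ‖F₀ θ‖ ^ 2

/-- `U(N, u₀, u₁) = ∫_{𝕋ᵈ} exp(2 |ξ(θ)| Θ(Λ⁻¹(N / |ξ(θ)|))) 𝓔(0, θ) dθ`, in `[0, ∞]`, where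
`Λ⁻¹` is the inverse of `Λ` on `[0, ∞)` and `F₀, F₁` represent `û₀, û₁`. -/
def weightedEnergy {d : ℕ} (a Θ Λ : ℝ → ℝ) (N : ℝ) (F₀ F₁ : (Fin d → ℝ) → ℂ) : ℝ≥0∞ :=
  ∫⁻ θ in cube d, ENNReal.ofReal
    (Real.exp (2 * xiNorm θ * Θ (Function.invFunOn Λ (Ici 0) (N / xiNorm θ))) *
      initialDensity a F₀ F₁ θ)

/-- The list `1, …, 1, 2, …, 2, …, d, …, d` in which `j` occurs `α_j` times. -/
def directions {d : ℕ} (α : Fin d → ℕ) : List (Fin d) :=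
  (List.finRange d).flatMap fun j => List.replicate (α j) j

/-- The partial derivative `∂^α f` on the cube: `D^{|α|} f` applied to `α_1` copies of `e_1`, …,
`α_d` copies of `e_d`. -/
def multiDeriv {d : ℕ} (α : Fin d → ℕ) (f : (Fin d → ℝ) → ℂ) (θ : Fin d → ℝ) : ℂ :=
  iteratedFDerivWithin ℝ (directions α).length f (cube d) θ
    fun i => Pi.single ((directions α).get i) (1 : ℝ)

/-- The Gevrey class `γ^ν_ρ` on `𝕋ᵈ`; the bound is uniform in `θ` and in `α`. -/
def gevreyClass (d : ℕ) (ν ρ : ℝ) : Set ((Fin d → ℝ) → ℂ) :=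
  {f | ContDiffOn ℝ ∞ f (cube d) ∧
    ∃ C : ℝ, ∀ α : Fin d → ℕ, ∀ θ ∈ cube d,
      ‖multiDeriv α f θ‖ * (ρ ^ (∑ j, α j) / ((∏ j, (α j)! : ℕ) : ℝ) ^ ν) ≤ C}

/-- `γ^ν_∞ = ⋃_{ρ > 0} γ^ν_ρ`. -/
def gevreyClassInfty (d : ℕ) (ν : ℝ) : Set ((Fin d → ℝ) → ℂ) :=
  ⋃ ρ ∈ Ioi (0 : ℝ), gevreyClass d ν ρ

/-- `F₀, F₁` represent `û₀, û₁`, the functions `ξ_j û₀` and `û₁` lie in the class `γ`, and all their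
derivatives vanish at `θ = 0`. -/
structure VanishingDataIn {d : ℕ} (γ : Set ((Fin d → ℝ) → ℂ)) (u₀ u₁ : Ell2 d)
    (F₀ F₁ : (Fin d → ℝ) → ℂ) : Prop where
  dtft_fst : IsDTFT u₀ F₀
  dtft_snd : IsDTFT u₁ F₁
  mem_fst : ∀ j : Fin d, (fun θ => (xi j θ : ℂ) * F₀ θ) ∈ γ
  mem_snd : F₁ ∈ γ
  vanish_fst : ∀ (j : Fin d) (α : Fin d → ℕ), multiDeriv α (fun θ => (xi j θ : ℂ) * F₀ θ) 0 = 0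
  vanish_snd : ∀ α : Fin d → ℕ, multiDeriv α F₁ 0 = 0

/-- `a₀ ≤ a(t) ≤ a₁` on `[0, ∞)` with positive constants. -/
def BoundedSpeed (a : ℝ → ℝ) : Prop :=
  ∃ a₀ a₁ : ℝ, 0 < a₀ ∧ 0 < a₁ ∧ ∀ t : ℝ, 0 ≤ t → a₀ ≤ a t ∧ a t ≤ a₁

/-- `∫₀ᵗ |a(s) - a_∞| ds ≤ Θ(t)` for some `a_∞ > 0`. -/
def Stabilizes (a Θ : ℝ → ℝ) : Prop :=
  ∃ aInf : ℝ, 0 < aInf ∧ ∀ t : ℝ, 0 ≤ t → ∫ s in (0 : ℝ)..t, |a s - aInf| ≤ Θ t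

/-- `a ∈ C^m([0, ∞))` and `|a^{(k)}(t)| ≤ C_k Ξ(t)^{-k}` for `k = 1, …, m`. -/
def OscillationBound (a Ξ : ℝ → ℝ) (m : ℕ) : Prop :=
  ContDiffOn ℝ m a (Ici 0) ∧
  ∀ k : ℕ, 1 ≤ k → k ≤ m → ∃ C : ℝ, 0 < C ∧
    ∀ t : ℝ, 0 ≤ t → |iteratedDerivWithin k a (Ici 0) t| ≤ C * (Ξ t ^ k)⁻¹

end SemiDiscreteWave

end

noncomputable section

namespace SemiDiscreteWave

/-! ### Flatness of Gevrey functions -/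

/-! On the Fourier side each frequency is an oscillator `w'' + a² r² w = 0` with `r = |ξ(θ)|`, and
the goal is a bound of its energy at any time by `C exp(c r^{-σ})` times the initial energy, `σ = (q
- p)/(1 - q)`. Time is split at the `s` with `r (1 + s)^{1-q} = M`, for a large constant `M`.

Up to `s` the speed is compared with the constant `a_∞`. The logarithmic energy growth is at most a
multiple of `r ∫ |a - a_∞|`, hence of `r (1 + s)^{1-p}` (`pseudoDifferential_zone_estimate`). After
`s` the oscillation of `a` is slow relative to `r`: an approximate solution of the Riccati equation,
built from `m` derivatives of `a`, has a residual of size `r^{-m} Ξ^{-m}` (`exists_approx_riccati`).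
The energy adapted to it grows at the integrable rate `r^{1-m} Ξ^{-m}`, whose integral over `[s, ∞)`
is again at most a multiple of `r (1 + s)^{1-p}` (`hyperbolic_zone_estimate`). By the choice of `s`
this quantity is a multiple of `r^{-σ}` (`oscillator_estimate`).

The oscillator estimate is proved for Hilbert space valued functions and tolerates a small error, so
no pointwise differential equation in `θ` is required. The transform is restricted to shells on
which `|ξ|` varies by a factor `1 + δ`, and `δ = 1/(1 + T)` keeps the accumulated error bounded up
to time `T`. Summing over the shells gives `energy_le_weighted`.

A Gevrey function of order `ν` that is flat at the origin is `O(exp(-(ρ/(e d ‖θ‖))^τ))` with `τ =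
1/(ν - 1)`, by optimising the order of its Taylor expansion (`norm_le_exp_of_mem_gevreyClass`). At
`ν = (1 - p)/(q - p)` one has `τ = σ`, so a large radius `ρ` is needed to beat `exp(c r^{-σ})`;
below it `τ > σ` and every radius works. Since `2 r Θ(Λ⁻¹(N/r))` is at most a multiple of `r^{-σ}`,
the same decay makes `U` finite. When `Θ` is bounded below by a multiple of `(1 + t)^{1-p}`, a large
`N` makes the weight in `U` dominate `exp(c r^{-σ})`, which gives uniform constants. Otherwise both
integrals are finite numbers and their ratio serves as a constant depending on the data
(`exists_const_mul_weightedEnergy`). -/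

theorem uniqueDiffOn_cube (d : ℕ) : UniqueDiffOn ℝ (cube d) := by
  have : cube d = Set.pi univ fun _ => Icc (-Real.pi) Real.pi := by
    rw [cube, ← Set.pi_univ_Icc]
  rw [this]
  exact UniqueDiffOn.univ_pi fun _ =>
    uniqueDiffOn_Icc (by linarith [Real.pi_pos])

theorem convex_cube (d : ℕ) : Convex ℝ (cube d) := convex_Icc _ _

theorem zero_mem_cube (d : ℕ) : (0 : Fin d → ℝ) ∈ cube d := by
  refine ⟨fun i => ?_, fun i => ?_⟩ <;> simp [Real.pi_pos.le]

theorem smul_mem_cube {d : ℕ} {θ : Fin d → ℝ} (hθ : θ ∈ cube d) {s : ℝ} (hs : s ∈ Icc (0 : ℝ) 1) :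
    s • θ ∈ cube d := by
  have := (convex_cube d).starConvex (zero_mem_cube d)
  exact (starConvex_zero_iff.1 this) hθ hs.1 hs.2

theorem cube_subset_closure_interior (d : ℕ) : cube d ⊆ closure (interior (cube d)) := by
  have h : (interior (cube d)).Nonempty := by
    have : cube d = Set.pi univ fun _ => Icc (-Real.pi) Real.pi := by
      rw [cube, ← Set.pi_univ_Icc]
    refine ⟨0, ?_⟩
    rw [this, interior_pi_set finite_univ]
    intro i _
    simp [Real.pi_pos]
  rw [(convex_cube d).closure_interior_eq_closure_of_nonempty_interior h]
  exact subset_closure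

/-- The iterated derivative on the cube along a word of coordinate directions. -/
def wordDeriv {d : ℕ} (f : (Fin d → ℝ) → ℂ) : List (Fin d) → (Fin d → ℝ) → ℂ
  | [] => f
  | j :: l => fun x => fderivWithin ℝ (wordDeriv f l) (cube d) x (Pi.single j 1)

theorem contDiffOn_wordDeriv {d : ℕ} {f : (Fin d → ℝ) → ℂ} (hf : ContDiffOn ℝ ∞ f (cube d))
    (l : List (Fin d)) : ContDiffOn ℝ ∞ (wordDeriv f l) (cube d) := by
  induction l with
  | nil => exact hf
  | cons j l ih =>
    exact (ih.fderivWithin (uniqueDiffOn_cube d) (by simp)).clm_apply contDiffOn_const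

theorem differentiableOn_wordDeriv {d : ℕ} {f : (Fin d → ℝ) → ℂ}
    (hf : ContDiffOn ℝ ∞ f (cube d)) (l : List (Fin d)) :
    DifferentiableOn ℝ (wordDeriv f l) (cube d) :=
  (contDiffOn_wordDeriv hf l).differentiableOn (by simp)

theorem iteratedFDerivWithin_eq_wordDeriv {d : ℕ} {f : (Fin d → ℝ) → ℂ}
    (hf : ContDiffOn ℝ ∞ f (cube d)) (l : List (Fin d)) :
    ∀ x ∈ cube d, iteratedFDerivWithin ℝ l.length f (cube d) x
      (fun i => Pi.single (l.get i) (1 : ℝ)) = wordDeriv f l x := by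
  induction l with
  | nil => intro x _; simp [wordDeriv]
  | cons j l ih =>
    intro x hx
    have hd : DifferentiableWithinAt ℝ (iteratedFDerivWithin ℝ l.length f (cube d)) (cube d) x :=
      hf.differentiableOn_iteratedFDerivWithin (by exact_mod_cast WithTop.coe_lt_top _)
        (uniqueDiffOn_cube d) x hx
    have h1 : wordDeriv f (j :: l) x = fderivWithin ℝ (fun y =>
        iteratedFDerivWithin ℝ l.length f (cube d) y
          (fun i => Pi.single (l.get i) (1 : ℝ))) (cube d) x (Pi.single j 1) := by
      simp only [wordDeriv]
      rw [fderivWithin_congr (fun y hy => (ih y hy).symm) (ih x hx).symm]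
    rw [h1]
    have h2 := ((ContinuousMultilinearMap.apply ℝ (fun _ : Fin l.length => Fin d → ℝ) ℂ
      (fun i => Pi.single (l.get i) (1 : ℝ))).hasFDerivAt.comp_hasFDerivWithinAt x
      hd.hasFDerivWithinAt).fderivWithin (uniqueDiffOn_cube d x hx)
    have h3 := congrArg (fun L => L (Pi.single j (1 : ℝ))) h2
    simp only [ContinuousLinearMap.comp_apply] at h3
    refine Eq.trans ?_ h3.symm
    simp only [List.length_cons]
    rw [iteratedFDerivWithin_succ_apply_left]
    rfl

/-- Second derivatives within the cube are symmetric, also at its boundary, so adjacent letters may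
be swapped. The Gevrey condition controls only the sorted words `directions α`, whereas
differentiating along a ray produces words in arbitrary order. -/
theorem wordDeriv_perm {d : ℕ} {f : (Fin d → ℝ) → ℂ} (hf : ContDiffOn ℝ ∞ f (cube d))
    {l l' : List (Fin d)} (h : l.Perm l') : ∀ x ∈ cube d, wordDeriv f l x = wordDeriv f l' x := by
  induction h with
  | nil => intro x _; rfl
  | cons j _ ih =>
    intro x hx
    simp only [wordDeriv]
    rw [fderivWithin_congr ih (ih x hx)]
  | swap i j l =>
    intro x hx
    have hc := contDiffOn_wordDeriv hf l
    have hs : IsSymmSndFDerivWithinAt ℝ (wordDeriv f l) (cube d) x :=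
      (hc x hx).isSymmSndFDerivWithinAt
        (by simpa using WithTop.coe_le_coe.2 (le_top : (2 : ℕ∞) ≤ ⊤)) (uniqueDiffOn_cube d)
        (cube_subset_closure_interior d hx) hx
    have hd : DifferentiableWithinAt ℝ (fderivWithin ℝ (wordDeriv f l) (cube d)) (cube d) x :=
      (hc.fderivWithin (uniqueDiffOn_cube d) (m := ∞) (by simp)).differentiableOn (by simp) x hx
    have key : ∀ i j : Fin d, wordDeriv f (i :: j :: l) x =
        fderivWithin ℝ (fderivWithin ℝ (wordDeriv f l) (cube d)) (cube d) x
          (Pi.single i 1) (Pi.single j 1) := by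
      intro i j
      simp only [wordDeriv]
      rw [fderivWithin_clm_apply (uniqueDiffOn_cube d x hx) hd (differentiableWithinAt_const _)]
      simp
    rw [key, key]
    exact hs _ _
  | trans _ _ ih1 ih2 => intro x hx; rw [ih1 x hx, ih2 x hx]

theorem directions_count {d : ℕ} (l : List (Fin d)) :
    (directions fun j => l.count j).Perm l := by
  rw [List.perm_iff_count]
  intro a
  have : ∀ L : List (Fin d), L.Nodup → List.count a (L.flatMap fun j => List.replicate (l.count j) j)
      = if a ∈ L then l.count a else 0 := by
    intro L hL
    induction L with
    | nil => simp
    | cons b L ih =>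
      rw [List.nodup_cons] at hL
      rw [List.flatMap_cons, List.count_append, ih hL.2, List.count_replicate]
      by_cases hab : b = a
      · subst hab; simp [hL.1]
      · have : a ≠ b := fun h => hab h.symm
        simp [hab, this]
  rw [directions, this _ (List.nodup_finRange d)]
  simp

theorem wordDeriv_eq_multiDeriv {d : ℕ} {f : (Fin d → ℝ) → ℂ} (hf : ContDiffOn ℝ ∞ f (cube d))
    (l : List (Fin d)) {x : Fin d → ℝ} (hx : x ∈ cube d) :
    wordDeriv f l x = multiDeriv (fun j => l.count j) f x := by
  rw [multiDeriv, iteratedFDerivWithin_eq_wordDeriv hf _ x hx]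
  exact (wordDeriv_perm hf (directions_count l) x hx).symm

theorem sum_count_eq_length {d : ℕ} (l : List (Fin d)) : ∑ j, l.count j = l.length := by
  induction l with
  | nil => simp
  | cons a l ih => simp [List.count_cons, Finset.sum_add_distrib, ih]

/-- Taylor's formula along the segment from `0` to `θ`. The derivative of `s ↦ wordDeriv f l (s •
θ)` is a sum of `d` longer words weighted by the coordinates of `θ`, so each integration from the
zero at the origin gains a factor `d ‖θ‖ s / k`. -/
theorem norm_wordDeriv_ray_le {d : ℕ} {f : (Fin d → ℝ) → ℂ} (hf : ContDiffOn ℝ ∞ f (cube d))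
    (h0 : ∀ l, wordDeriv f l 0 = 0) {n : ℕ} {M : ℝ}
    (hM : ∀ l : List (Fin d), l.length = n → ∀ x ∈ cube d, ‖wordDeriv f l x‖ ≤ M)
    {θ : Fin d → ℝ} (hθ : θ ∈ cube d) (k : ℕ) : ∀ l : List (Fin d), l.length + k = n →
      ∀ s ∈ Icc (0 : ℝ) 1, ‖wordDeriv f l (s • θ)‖ ≤ M * (d * ‖θ‖) ^ k / k ! * s ^ k := by
  induction k with
  | zero =>
    intro l hl s hs
    simpa using hM l hl _ (smul_mem_cube hθ hs)
  | succ k ih =>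
    intro l hl s hs
    set h : ℝ → ℂ := fun s => wordDeriv f l (s • θ) with hh
    set h' : ℝ → ℂ := fun s => fderivWithin ℝ (wordDeriv f l) (cube d) (s • θ) θ with hh'
    have hder : ∀ s ∈ Icc (0 : ℝ) 1, HasDerivWithinAt h (h' s) (Icc 0 1) s := by
      intro s hs
      have hd := (differentiableOn_wordDeriv hf l (s • θ) (smul_mem_cube hθ hs)).hasFDerivWithinAt
      have hg : HasDerivWithinAt (fun s : ℝ => s • θ) θ (Icc 0 1) s := by
        simpa using ((hasDerivAt_id s).smul_const θ).hasDerivWithinAt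
      exact hd.comp_hasDerivWithinAt s hg fun t ht => smul_mem_cube hθ ht
    have hbound : ∀ s ∈ Icc (0 : ℝ) 1, ‖h' s‖ ≤ (M * (d * ‖θ‖) ^ (k + 1) / k !) * s ^ k := by
      intro s hs
      have hsum : h' s = ∑ j, (θ j) • wordDeriv f (j :: l) (s • θ) := by
        simp only [hh', wordDeriv]
        generalize fderivWithin ℝ (wordDeriv f l) (cube d) (s • θ) = A
        conv_lhs => rw [← Finset.univ_sum_single θ]
        rw [map_sum]
        refine Finset.sum_congr rfl fun j _ => ?_
        rw [← map_smul, ← Pi.single_smul]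
        simp
      rw [hsum]
      calc ‖∑ j, (θ j) • wordDeriv f (j :: l) (s • θ)‖
          ≤ ∑ j : Fin d, ‖θ‖ * (M * (d * ‖θ‖) ^ k / k ! * s ^ k) := by
            refine norm_sum_le_of_le _ fun j _ => ?_
            rw [norm_smul]
            refine mul_le_mul (norm_le_pi_norm θ j) (ih _ ?_ s hs) (norm_nonneg _) (norm_nonneg _)
            simp only [List.length_cons]; omega
        _ = _ := by
            rw [Finset.sum_const, Finset.card_univ, Fintype.card_fin, nsmul_eq_mul]; ring
    have hcont : ContinuousOn h (Icc 0 1) := fun s hs => (hder s hs).continuousWithinAt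
    have := image_norm_le_of_norm_deriv_right_le_deriv_boundary (a := 0) (b := 1) (f := h)
      (f' := h') (B := fun s => M * (d * ‖θ‖) ^ (k + 1) / (k + 1)! * s ^ (k + 1))
      (B' := fun s => (M * (d * ‖θ‖) ^ (k + 1) / k !) * s ^ k) hcont
      (fun s hs => (hder s ⟨hs.1, hs.2.le⟩).mono_of_mem_nhdsWithin
        (Icc_mem_nhdsGE_of_mem hs))
      (by simp [hh, h0]) ?_ (fun s hs => hbound s ⟨hs.1, hs.2.le⟩) hs
    · exact this
    · intro s
      have := (hasDerivAt_pow (k + 1) s).const_mul (M * (d * ‖θ‖) ^ (k + 1) / (k + 1)!)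
      refine this.congr_deriv ?_
      have : ((k ! : ℕ) : ℝ) ≠ 0 := by positivity
      rw [Nat.factorial_succ]
      push_cast
      field_simp
      try simp

/-- The Taylor remainder divides by `n!` the Gevrey bound of order `n`; since `∏ α_j! ≤ n!`, that
bound is at most `C n!^ν / ρ^n`, and `n!^{ν-1}` remains. -/
theorem norm_le_of_mem_gevreyClass {d : ℕ} {ν ρ : ℝ} (hν : 1 < ν) (hρ : 0 < ρ)
    {f : (Fin d → ℝ) → ℂ} (hf : f ∈ gevreyClass d ν ρ) (h0 : ∀ α, multiDeriv α f 0 = 0) :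
    ∃ C : ℝ, 0 ≤ C ∧ ∀ θ ∈ cube d, ∀ n : ℕ,
      ‖f θ‖ ≤ C * (d * ‖θ‖ / ρ) ^ n * (n ! : ℝ) ^ (ν - 1) := by
  obtain ⟨hc, C, hC⟩ := hf
  have hC0 : 0 ≤ C := le_trans (by positivity) (hC 0 0 (zero_mem_cube d))
  refine ⟨C, hC0, fun θ hθ n => ?_⟩
  have hM : ∀ l : List (Fin d), l.length = n → ∀ x ∈ cube d,
      ‖wordDeriv f l x‖ ≤ C * (n ! : ℝ) ^ ν / ρ ^ n := by
    intro l hl x hx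
    rw [wordDeriv_eq_multiDeriv hc l hx]
    have h := hC (fun j => l.count j) x hx
    rw [sum_count_eq_length, hl] at h
    set P : ℕ := ∏ j, (l.count j)! with hP
    have hPpos : 0 < P := Finset.prod_pos fun j _ => Nat.factorial_pos _
    have hPle : P ≤ n ! := by
      have := Nat.prod_factorial_dvd_factorial_sum Finset.univ (fun j => l.count j)
      rw [sum_count_eq_length, hl] at this
      exact Nat.le_of_dvd (Nat.factorial_pos _) this
    have hPν : (0 : ℝ) < (P : ℝ) ^ ν := Real.rpow_pos_of_pos (by exact_mod_cast hPpos) _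
    have hle : (P : ℝ) ^ ν ≤ (n ! : ℝ) ^ ν :=
      Real.rpow_le_rpow (by positivity) (by exact_mod_cast hPle) (by linarith)
    rw [le_div_iff₀ (by positivity)]
    rw [← mul_div_assoc, div_le_iff₀ hPν] at h
    exact h.trans (mul_le_mul_of_nonneg_left hle hC0)
  have h := norm_wordDeriv_ray_le hc (fun l => by
    rw [wordDeriv_eq_multiDeriv hc l (zero_mem_cube d), h0]) hM hθ n [] (by simp) 1 (by simp)
  simp only [one_smul, wordDeriv, one_pow, mul_one] at h
  refine h.trans (le_of_eq ?_)
  have hn : (0 : ℝ) < (n ! : ℝ) := by exact_mod_cast Nat.factorial_pos n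
  rw [Real.rpow_sub hn, Real.rpow_one, div_pow]
  field_simp

/-- A Gevrey function of order `1 + 1 / τ` which is flat at the origin is exponentially small. -/
theorem norm_le_exp_of_mem_gevreyClass {d : ℕ} (hd : 1 ≤ d) {ν ρ τ : ℝ} (hρ : 0 < ρ)
    (hτ : 0 < τ) (hντ : (ν - 1) * τ = 1)
    {f : (Fin d → ℝ) → ℂ} (hf : f ∈ gevreyClass d ν ρ) (h0 : ∀ α, multiDeriv α f 0 = 0) :
    ∃ C : ℝ, 0 ≤ C ∧ ∀ θ ∈ cube d, θ ≠ 0 →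
      ‖f θ‖ ≤ C * Real.exp (-((ρ / (Real.exp 1 * d * ‖θ‖)) ^ τ)) := by
  have hν : 1 < ν := by
    by_contra h
    nlinarith
  obtain ⟨C, hC, h⟩ := norm_le_of_mem_gevreyClass hν hρ hf h0
  refine ⟨C * Real.exp 1, by positivity, fun θ hθ hne => ?_⟩
  have hd' : (0 : ℝ) < d := by exact_mod_cast hd
  have hθ' : 0 < ‖θ‖ := norm_pos_iff.2 hne
  set y : ℝ := ρ / (Real.exp 1 * d * ‖θ‖) with hy
  have hy0 : 0 < y := by positivity
  -- This is the nearly optimal Taylor order: `n^{ν-1} ≤ y`, so the `n` factors combine to at most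
  -- `e^{-n}`. Rounding down costs only the factor `e` in the constant.
  set n : ℕ := ⌊y ^ τ⌋₊ with hn
  have hny : (n : ℝ) ≤ y ^ τ := Nat.floor_le (by positivity)
  have hny' : y ^ τ < n + 1 := Nat.lt_floor_add_one _
  have hpow : (n : ℝ) ^ (ν - 1) ≤ y := by
    calc (n : ℝ) ^ (ν - 1) ≤ (y ^ τ) ^ (ν - 1) :=
          Real.rpow_le_rpow (by positivity) hny (by linarith)
      _ = y := by rw [← Real.rpow_mul hy0.le, mul_comm, hντ, Real.rpow_one]
  have hfac : ((n ! : ℕ) : ℝ) ^ (ν - 1) ≤ y ^ n := by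
    calc ((n ! : ℕ) : ℝ) ^ (ν - 1) ≤ ((n : ℝ) ^ n) ^ (ν - 1) :=
          Real.rpow_le_rpow (by positivity) (by exact_mod_cast Nat.factorial_le_pow n)
            (by linarith)
      _ = ((n : ℝ) ^ (ν - 1)) ^ n := by
          rw [← Real.rpow_natCast, ← Real.rpow_natCast, ← Real.rpow_mul (by positivity),
            ← Real.rpow_mul (by positivity), mul_comm]
      _ ≤ y ^ n := pow_le_pow_left₀ (by positivity) hpow n
  have hxy : d * ‖θ‖ / ρ * y = Real.exp (-1) := by
    rw [hy, Real.exp_neg]; field_simp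
  calc ‖f θ‖ ≤ C * (d * ‖θ‖ / ρ) ^ n * ((n ! : ℕ) : ℝ) ^ (ν - 1) := h θ hθ n
    _ ≤ C * (d * ‖θ‖ / ρ) ^ n * y ^ n := by gcongr
    _ = C * Real.exp (-n) := by
        rw [mul_assoc, ← mul_pow, hxy, ← Real.exp_nat_mul]; ring_nf
    _ ≤ C * Real.exp (1 - y ^ τ) := by gcongr; linarith
    _ = C * Real.exp 1 * Real.exp (-(y ^ τ)) := by
        rw [mul_assoc, ← Real.exp_add]; ring_nf

/-! ### Symbol classes and an approximate solution of the Riccati equation -/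

/-- `|f(r, t)| ≤ C r^{-j} X(t)^{-k}` in the zone `r X(t) ≥ 1`. -/
def SymbolBound (X : ℝ → ℝ) (j k : ℕ) (f : ℝ → ℝ → ℂ) : Prop :=
  ∃ C : ℝ, 0 ≤ C ∧ ∀ r t : ℝ, 0 < r → 0 ≤ t → 1 ≤ r * X t →
    ‖f r t‖ ≤ C * ((r ^ j)⁻¹ * (X t ^ k)⁻¹)

/-- `f` is `l` times differentiable in `t`, and each derivative in `t` improves the bound
`r^{-j} X(t)^{-k}` by a factor `X(t)^{-1}`. -/
def IsSymbol (X : ℝ → ℝ) : ℕ → ℕ → ℕ → (ℝ → ℝ → ℂ) → Prop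
  | 0, j, k, f => SymbolBound X j k f
  | l + 1, j, k, f => SymbolBound X j k f ∧ ∃ f' : ℝ → ℝ → ℂ,
      (∀ r t : ℝ, 0 < r → 0 ≤ t → HasDerivWithinAt (f r) (f' r t) (Ici 0) t) ∧
      IsSymbol X l j (k + 1) f'

variable {X : ℝ → ℝ}

namespace SymbolBound

variable {j k j' k' : ℕ} {f g : ℝ → ℝ → ℂ}

theorem congr (hf : SymbolBound X j k f) (h : ∀ r t, 0 < r → 0 ≤ t → g r t = f r t) :
    SymbolBound X j k g := by
  obtain ⟨C, hC, hb⟩ := hf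
  exact ⟨C, hC, fun r t hr ht hz => by rw [h r t hr ht]; exact hb r t hr ht hz⟩

theorem add (hf : SymbolBound X j k f) (hg : SymbolBound X j k g) :
    SymbolBound X j k (fun r t => f r t + g r t) := by
  obtain ⟨C, hC, hb⟩ := hf
  obtain ⟨D, hD, hb'⟩ := hg
  refine ⟨C + D, by positivity, fun r t hr ht hz => (norm_add_le _ _).trans ?_⟩
  rw [add_mul]
  exact add_le_add (hb r t hr ht hz) (hb' r t hr ht hz)

theorem mul (hf : SymbolBound X j k f) (hg : SymbolBound X j' k' g) :
    SymbolBound X (j + j') (k + k') (fun r t => f r t * g r t) := by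
  obtain ⟨C, hC, hb⟩ := hf
  obtain ⟨D, hD, hb'⟩ := hg
  refine ⟨C * D, by positivity, fun r t hr ht hz => ?_⟩
  rw [norm_mul]
  refine (mul_le_mul (hb r t hr ht hz) (hb' r t hr ht hz) (norm_nonneg _)
    ((norm_nonneg _).trans (hb r t hr ht hz))).trans (le_of_eq ?_)
  simp only [pow_add, mul_inv]
  ring

theorem const_mul (c : ℂ) (hf : SymbolBound X j k f) :
    SymbolBound X j k (fun r t => c * f r t) := by
  obtain ⟨C, hC, hb⟩ := hf
  refine ⟨‖c‖ * C, by positivity, fun r t hr ht hz => ?_⟩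
  rw [norm_mul, mul_assoc]
  exact mul_le_mul_of_nonneg_left (hb r t hr ht hz) (norm_nonneg _)

theorem div_param (hf : SymbolBound X j k f) :
    SymbolBound X (j + 1) k (fun r t => f r t / (r : ℂ)) := by
  obtain ⟨C, hC, hb⟩ := hf
  refine ⟨C, hC, fun r t hr ht hz => ?_⟩
  rw [norm_div, Complex.norm_real, Real.norm_of_nonneg hr.le, div_le_iff₀ hr]
  refine (hb r t hr ht hz).trans (le_of_eq ?_)
  rw [pow_succ]
  field_simp

/-- In the zone `r X ≥ 1` a factor `(r X)⁻¹` may be discarded. This is what makes `(j, k) ↦ (j + 1,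
k + 1)` a gain of order. -/
theorem lower (hX : ∀ t, 0 ≤ t → 0 < X t) (hf : SymbolBound X (j + 1) (k + 1) f) :
    SymbolBound X j k f := by
  obtain ⟨C, hC, hb⟩ := hf
  refine ⟨C, hC, fun r t hr ht hz => (hb r t hr ht hz).trans ?_⟩
  refine mul_le_mul_of_nonneg_left ?_ hC
  have hXt := hX t ht
  rw [← mul_inv, ← mul_inv]
  refine inv_anti₀ (by positivity) ?_
  calc r ^ j * X t ^ k ≤ r ^ j * X t ^ k * (r * X t) :=
        le_mul_of_one_le_right (by positivity) hz
    _ = _ := by ring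

end SymbolBound

namespace IsSymbol

variable {f g : ℝ → ℝ → ℂ}

theorem bound {l j k : ℕ} (hf : IsSymbol X l j k f) : SymbolBound X j k f := by
  cases l with
  | zero => exact hf
  | succ l => exact hf.1

theorem congr {l j k : ℕ} (hf : IsSymbol X l j k f)
    (h : ∀ r t, 0 < r → 0 ≤ t → g r t = f r t) : IsSymbol X l j k g := by
  cases l with
  | zero => exact SymbolBound.congr hf h
  | succ l =>
    obtain ⟨hb, f', hd, hf'⟩ := hf
    exact ⟨hb.congr h, f', fun r t hr ht => (hd r t hr ht).congr (fun s hs => h r s hr hs)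
      (h r t hr ht), hf'⟩

theorem of_succ {l : ℕ} : ∀ {j k : ℕ} {f : ℝ → ℝ → ℂ}, IsSymbol X (l + 1) j k f →
    IsSymbol X l j k f := by
  induction l with
  | zero => exact fun h => h.1
  | succ l ih => exact fun ⟨hb, f', hd, hf'⟩ => ⟨hb, f', hd, ih hf'⟩

theorem zero (l : ℕ) : ∀ j k : ℕ, IsSymbol X l j k (fun _ _ => 0) := by
  have hb : ∀ j k : ℕ, SymbolBound X j k (fun _ _ => 0) :=
    fun j k => ⟨0, le_rfl, fun r t _ _ _ => by simp⟩
  induction l with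
  | zero => exact hb
  | succ l ih =>
    exact fun j k => ⟨hb j k, fun _ _ => 0, fun _ _ _ _ => hasDerivWithinAt_const _ _ _,
      ih j (k + 1)⟩

theorem add {l : ℕ} : ∀ {j k : ℕ} {f g : ℝ → ℝ → ℂ}, IsSymbol X l j k f → IsSymbol X l j k g →
    IsSymbol X l j k (fun r t => f r t + g r t) := by
  induction l with
  | zero => exact fun hf hg => SymbolBound.add hf hg
  | succ l ih =>
    rintro j k f g ⟨hb, f', hd, hf'⟩ ⟨hbg, g', hdg, hg'⟩
    exact ⟨hb.add hbg, _, fun r t hr ht => (hd r t hr ht).add (hdg r t hr ht), ih hf' hg'⟩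

theorem const_mul {l : ℕ} (c : ℂ) : ∀ {j k : ℕ} {f : ℝ → ℝ → ℂ}, IsSymbol X l j k f →
    IsSymbol X l j k (fun r t => c * f r t) := by
  induction l with
  | zero => exact fun hf => SymbolBound.const_mul c hf
  | succ l ih =>
    rintro j k f ⟨hb, f', hd, hf'⟩
    exact ⟨hb.const_mul c, _, fun r t hr ht => (hd r t hr ht).const_mul c, ih hf'⟩

theorem mul {l : ℕ} : ∀ {j k j' k' : ℕ} {f g : ℝ → ℝ → ℂ}, IsSymbol X l j k f →
    IsSymbol X l j' k' g → IsSymbol X l (j + j') (k + k') (fun r t => f r t * g r t) := by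
  induction l with
  | zero => exact fun hf hg => SymbolBound.mul hf hg
  | succ l ih =>
    intro j k j' k' f g hf hg
    have hf0 := hf.of_succ
    have hg0 := hg.of_succ
    obtain ⟨hb, f', hd, hf'⟩ := hf
    obtain ⟨hbg, g', hdg, hg'⟩ := hg
    refine ⟨hb.mul hbg, _, fun r t hr ht => (hd r t hr ht).mul (hdg r t hr ht), ?_⟩
    have h1 := ih hf' hg0
    have h2 := ih hf0 hg'
    rw [show k + 1 + k' = k + k' + 1 by ring] at h1
    exact h1.add h2

theorem div_param {l : ℕ} : ∀ {j k : ℕ} {f : ℝ → ℝ → ℂ}, IsSymbol X l j k f →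
    IsSymbol X l (j + 1) k (fun r t => f r t / (r : ℂ)) := by
  induction l with
  | zero => exact fun hf => SymbolBound.div_param hf
  | succ l ih =>
    rintro j k f ⟨hb, f', hd, hf'⟩
    exact ⟨hb.div_param, _, fun r t hr ht => (hd r t hr ht).div_const _, ih hf'⟩

theorem lower (hX : ∀ t, 0 ≤ t → 0 < X t) {l : ℕ} : ∀ {j k : ℕ} {f : ℝ → ℝ → ℂ},
    IsSymbol X l (j + 1) (k + 1) f → IsSymbol X l j k f := by
  induction l with
  | zero => exact fun hf => SymbolBound.lower hX hf
  | succ l ih =>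
    rintro j k f ⟨hb, f', hd, hf'⟩
    exact ⟨hb.lower hX, f', hd, ih hf'⟩

theorem lower_add (hX : ∀ t, 0 ≤ t → 0 < X t) {l j k : ℕ} (n : ℕ) {f : ℝ → ℝ → ℂ}
    (hf : IsSymbol X l (j + n) (k + n) f) : IsSymbol X l j k f := by
  induction n with
  | zero => exact hf
  | succ n ih => exact ih (hf.lower hX)

theorem inv_of_bounded_below {c : ℝ} (hc : 0 < c) {l : ℕ} : ∀ {f : ℝ → ℝ → ℂ},
    (∀ r t, 0 < r → 0 ≤ t → c ≤ ‖f r t‖) → IsSymbol X l 0 0 f →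
    IsSymbol X l 0 0 (fun r t => (f r t)⁻¹) := by
  have hb : ∀ f : ℝ → ℝ → ℂ, (∀ r t, 0 < r → 0 ≤ t → c ≤ ‖f r t‖) →
      SymbolBound X 0 0 (fun r t => (f r t)⁻¹) := by
    intro f hf
    refine ⟨c⁻¹, by positivity, fun r t hr ht _ => ?_⟩
    rw [norm_inv]
    simpa using inv_anti₀ hc (hf r t hr ht)
  induction l with
  | zero => exact fun h _ => hb _ h
  | succ l ih =>
    intro f h hf
    have hi := ih h hf.of_succ
    obtain ⟨_, f', hd, hf'⟩ := hf
    refine ⟨hb _ h, fun r t => -1 * (f' r t * ((f r t)⁻¹ * (f r t)⁻¹)), fun r t hr ht => ?_, ?_⟩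
    · have hne : f r t ≠ 0 := norm_pos_iff.1 (hc.trans_le (h r t hr ht))
      refine ((hd r t hr ht).inv hne).congr_deriv ?_
      field_simp
    · exact (hf'.mul (hi.mul hi)).const_mul _

end IsSymbol

theorem OscillationBound.isSymbol {a : ℝ → ℝ} {m : ℕ} (ha : BoundedSpeed a)
    (h : OscillationBound a X m) : IsSymbol X m 0 0 (fun _ t => (a t : ℂ)) := by
  have key : ∀ l n : ℕ, n + l = m →
      IsSymbol X l 0 n (fun _ t => ((iteratedDerivWithin n a (Ici 0) t : ℝ) : ℂ)) := by
    have hb : ∀ n, n ≤ m →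
        SymbolBound X 0 n (fun _ t => ((iteratedDerivWithin n a (Ici 0) t : ℝ) : ℂ)) := by
      intro n hn
      rcases Nat.eq_zero_or_pos n with rfl | hpos
      · obtain ⟨a₀, a₁, h0, h1, hb⟩ := ha
        refine ⟨a₁, h1.le, fun r t _ ht _ => ?_⟩
        have := hb t ht
        simp only [iteratedDerivWithin_zero, Complex.norm_real, pow_zero, inv_one, mul_one]
        rw [Real.norm_of_nonneg (by linarith)]
        exact this.2
      · obtain ⟨C, hC, hCb⟩ := h.2 n hpos hn
        refine ⟨C, hC.le, fun r t _ ht _ => ?_⟩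
        rw [Complex.norm_real, Real.norm_eq_abs]
        simpa using hCb t ht
    intro l
    induction l with
    | zero => exact fun n hn => hb n (by omega)
    | succ l ih =>
      intro n hn
      refine ⟨hb n (by omega), _, fun r t _ ht => ?_, ih (n + 1) (by omega)⟩
      have hdiff : DifferentiableOn ℝ (iteratedDerivWithin n a (Ici 0)) (Ici 0) :=
        h.1.differentiableOn_iteratedDerivWithin (by exact_mod_cast (by omega : n < m))
          (uniqueDiffOn_Ici 0)
      have := (hdiff t ht).hasDerivWithinAt
      rw [iteratedDerivWithin_succ]
      exact this.ofReal_comp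
  simpa using key m 0 (by omega)

/-- An approximate solution `ψ = r ζ` of the Riccati equation `ψ' + ψ² + r² a² = 0`. -/
theorem exists_approx_riccati {a : ℝ → ℝ} {m : ℕ} (hm : 1 ≤ m) (hX : ∀ t, 0 ≤ t → 0 < X t)
    (ha : BoundedSpeed a) (h : OscillationBound a X m) :
    ∃ ζ ζ' : ℝ → ℝ → ℂ, (∀ r t : ℝ, 0 < r → 0 ≤ t → HasDerivWithinAt (ζ r) (ζ' r t) (Ici 0) t) ∧
      SymbolBound X 1 1 (fun r t => ζ r t - Complex.I * a t) ∧
      SymbolBound X m m (fun r t => ζ' r t / r + ζ r t ^ 2 + (a t : ℂ) ^ 2) := by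
  obtain ⟨M, rfl⟩ : ∃ M, m = M + 1 := ⟨m - 1, by omega⟩
  have hsym := h.isSymbol ha
  obtain ⟨a₀, a₁, ha₀, -, hab⟩ := ha
  have ha0 : ∀ t, 0 ≤ t → (a t : ℂ) ≠ 0 := fun t ht => by
    exact_mod_cast (ha₀.trans_le (hab t ht).1).ne'
  have hinv : IsSymbol X (M + 1) 0 0 (fun _ t => (a t : ℂ)⁻¹) :=
    hsym.inv_of_bounded_below ha₀ fun r t _ ht => by
      rw [Complex.norm_real, Real.norm_of_nonneg (ha₀.le.trans (hab t ht).1)]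
      exact (hab t ht).1
  have weaken : ∀ {n l j k : ℕ} {f : ℝ → ℝ → ℂ}, IsSymbol X (l + n) j k f → IsSymbol X l j k f := by
    intro n
    induction n with
    | zero => exact fun h => h
    | succ n ih => exact fun h => ih h.of_succ
  -- Here `n` counts the corrections made and `l` the `t`-derivatives still available for the
  -- residual. Each correction spends one derivative and improves the residual by one order `(r
  -- X)⁻¹`, starting from `ζ = i a` with residual `i a' / r`.
  have key : ∀ l n : ℕ, n + l = M → ∃ ζ ζ' : ℝ → ℝ → ℂ,
      (∀ r t : ℝ, 0 < r → 0 ≤ t → HasDerivWithinAt (ζ r) (ζ' r t) (Ici 0) t) ∧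
      IsSymbol X (l + 1) 1 1 (fun r t => ζ r t - Complex.I * a t) ∧
      IsSymbol X l (n + 1) (n + 1)
        (fun r t => ζ' r t / r + ζ r t ^ 2 + (a t : ℂ) ^ 2) := by
    intro l n
    induction n generalizing l with
    | zero =>
      rintro hl
      obtain rfl : l = M := by omega
      obtain ⟨hb, a', hd, ha'⟩ := hsym
      refine ⟨fun _ t => Complex.I * a t, fun r t => Complex.I * a' r t,
        fun r t hr ht => (hd r t hr ht).const_mul _, ?_, ?_⟩
      · simpa using IsSymbol.zero (X := X) (l + 1) 1 1
      · refine (ha'.const_mul Complex.I).div_param.congr fun r t hr ht => ?_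
        rw [mul_pow, Complex.I_sq]
        ring
    | succ n ih =>
      intro hl
      obtain ⟨ζ, ζ', hd, hσ, hR⟩ := ih (l + 1) (by omega)
      -- A Newton step: with residual `R`, linearising `ζ²` at `i a` suggests subtracting `e = R /
      -- (2 i a)`. The new residual is `-e'/r - 2 (ζ - i a) e + e²`, and all three terms are one
      -- order better.
      set e : ℝ → ℝ → ℂ := fun r t => (2 * Complex.I)⁻¹ *
        ((ζ' r t / r + ζ r t ^ 2 + (a t : ℂ) ^ 2) * (a t : ℂ)⁻¹) with he
      have hesym : IsSymbol X (l + 1) (n + 1) (n + 1) e :=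
        (hR.mul (weaken (n := n + 1) (by rw [show l + 1 + (n + 1) = M + 1 by omega]; exact hinv))).const_mul _
      obtain ⟨-, e', hde, he'⟩ := id hesym
      refine ⟨fun r t => ζ r t - e r t, fun r t => ζ' r t - e' r t,
        fun r t hr ht => (hd r t hr ht).sub (hde r t hr ht), ?_, ?_⟩
      · have hlow : IsSymbol X (l + 1) 1 1 e :=
          IsSymbol.lower_add hX n (by rwa [add_comm 1 n])
        exact (hσ.of_succ.add (hlow.const_mul (-1))).congr fun r t _ _ => by ring
      · have h1 := (he'.const_mul (-1)).div_param
        have h2 := ((hσ.of_succ.of_succ.mul hesym.of_succ).const_mul (-2))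
        have h3 : IsSymbol X l (n + 2) (n + 2) fun r t => e r t * e r t :=
          IsSymbol.lower_add hX n ((by
            have := hesym.of_succ.mul hesym.of_succ
            rwa [show n + 1 + (n + 1) = n + 2 + n by ring] at this))
        rw [show 1 + (n + 1) = n + 2 by ring] at h2
        refine ((h1.add h2).add h3).congr fun r t hr ht => ?_
        have hat := ha0 t ht
        have hrel : ζ' r t / r + ζ r t ^ 2 + (a t : ℂ) ^ 2 = 2 * Complex.I * a t * e r t := by
          simp only [he]
          field_simp [Complex.I_ne_zero]
        linear_combination hrel
  obtain ⟨ζ, ζ', hd, hσ, hR⟩ := key 0 M (by omega)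
  exact ⟨ζ, ζ', hd, hσ.bound, hR⟩

/-! ### Energy estimates for Hilbert space valued oscillators -/

/-- Grönwall's inequality with the rate given through a primitive `K`, so that no integrability of
`k` enters. -/
theorem le_mul_exp_of_deriv_le {Q Q' K k : ℝ → ℝ} {s t : ℝ} (hst : s ≤ t)
    (hQc : ContinuousOn Q (Icc s t)) (hKc : ContinuousOn K (Icc s t))
    (hQ : ∀ τ ∈ Ioo s t, HasDerivAt Q (Q' τ) τ) (hK : ∀ τ ∈ Ioo s t, HasDerivAt K (k τ) τ)
    (h : ∀ τ ∈ Ioo s t, Q' τ ≤ k τ * Q τ) : Q t ≤ Q s * Real.exp (K t - K s) := by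
  have hder : ∀ τ ∈ Ioo s t, HasDerivAt (fun τ => Q τ * Real.exp (-K τ))
      (Q' τ * Real.exp (-K τ) + Q τ * (Real.exp (-K τ) * -k τ)) τ :=
    fun τ hτ => (hQ τ hτ).mul (hK τ hτ).neg.exp
  have hanti : AntitoneOn (fun τ => Q τ * Real.exp (-K τ)) (Icc s t) := by
    refine antitoneOn_of_deriv_nonpos (convex_Icc _ _)
      (hQc.mul (Real.continuous_exp.comp_continuousOn hKc.neg)) ?_ ?_
    · rw [interior_Icc]
      exact fun τ hτ => (hder τ hτ).differentiableAt.differentiableWithinAt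
    · rw [interior_Icc]
      intro τ hτ
      rw [(hder τ hτ).deriv]
      have := h τ hτ
      have he := Real.exp_pos (-K τ)
      nlinarith
  have := hanti (left_mem_Icc.2 hst) (right_mem_Icc.2 hst) hst
  simp only at this
  calc Q t = Q t * Real.exp (-K t) * Real.exp (K t) := by
        rw [mul_assoc, ← Real.exp_add]; simp
    _ ≤ Q s * Real.exp (-K s) * Real.exp (K t) := by gcongr
    _ = Q s * Real.exp (K t - K s) := by
        rw [mul_assoc, ← Real.exp_add]; ring_nf

variable {H : Type*} [NormedAddCommGroup H] [InnerProductSpace ℝ H]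

/-- The energy `|v - x w|² / y + y |w|²` adapted to the frequency `x + i y`. -/
def modifiedEnergy (x y : ℝ) (w v : H) : ℝ := ‖v - x • w‖ ^ 2 / y + y * ‖w‖ ^ 2

/-- For `ψ = x + i y`, the product of `y` and the modified energy is formally `|v - ψ w|²`. If `ψ' +
ψ² + c = 0` and `w'' + c w = 0`, then `v - ψ w` decays at rate `ψ` and `y' = -2 x y`, so the
modified energy is conserved. In general its relative growth is controlled by the real and imaginary
Riccati residuals and by the error `η`, all divided by `y`. -/
theorem modifiedEnergy_deriv_le {w v : ℝ → H} {v' : H} {x y : ℝ → ℝ} {x' y' c η τ : ℝ}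
    (hy : 0 < y τ) (hw : HasDerivAt w (v τ) τ) (hv : HasDerivAt v v' τ)
    (hx' : HasDerivAt x x' τ) (hy' : HasDerivAt y y' τ)
    (hη0 : 0 ≤ η) (hη : ‖v' + c • w τ‖ ≤ η * ‖w τ‖) :
    ∃ Q' : ℝ, HasDerivAt (fun τ => modifiedEnergy (x τ) (y τ) (w τ) (v τ)) Q' τ ∧
      Q' ≤ (|x' + x τ ^ 2 - y τ ^ 2 + c| + |y' + 2 * x τ * y τ| + η) / y τ *
        modifiedEnergy (x τ) (y τ) (w τ) (v τ) := by
  have hZ := hv.sub (hx'.smul hw)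
  have h1 := (hZ.norm_sq.div hy' hy.ne').add (hy'.mul hw.norm_sq)
  refine ⟨_, h1, ?_⟩
  simp only [modifiedEnergy]
  set g : H := v' + c • w τ with hg
  set Z : H := v τ - x τ • w τ with hZdef
  have hZ' : (v - x • w) τ = Z := rfl
  have hv' : v' - (x τ • v τ + x' • w τ) =
      g - (x' + x τ ^ 2 - y τ ^ 2 + c) • w τ - y τ ^ 2 • w τ - x τ • Z := by
    rw [hg, hZdef]; module
  have hvw : v τ = Z + x τ • w τ := by rw [hZdef]; module
  set ρ₁ := x' + x τ ^ 2 - y τ ^ 2 + c with hρ₁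
  set ρ₂ := y' + 2 * x τ * y τ with hρ₂
  have hy2 : y' = ρ₂ - 2 * x τ * y τ := by rw [hρ₂]; ring
  rw [hZ', hv']
  rw [hvw]
  simp only [inner_sub_right, inner_add_right, inner_smul_right, real_inner_self_eq_norm_sq]
  rw [real_inner_comm Z (w τ), hy2]
  set A := ‖Z‖
  set B := ‖w τ‖
  have hin : inner ℝ Z g - ρ₁ * inner ℝ Z (w τ) ≤ (|ρ₁| + η) * (A * B) := by
    have h2 : inner ℝ Z g ≤ A * (η * B) :=
      (real_inner_le_norm _ _).trans (mul_le_mul_of_nonneg_left hη (norm_nonneg _))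
    have h3 : -(ρ₁ * inner ℝ Z (w τ)) ≤ |ρ₁| * (A * B) := by
      refine (neg_le_abs _).trans ?_
      rw [abs_mul]
      exact mul_le_mul_of_nonneg_left (abs_real_inner_le_norm _ _) (abs_nonneg _)
    linarith
  set I := inner ℝ Z (w τ)
  set J := inner ℝ Z g
  set X := x τ
  set Y := y τ
  -- The weights `1/y` and `y` are such that the mixed term is absorbed without a loss.
  have hAB : 2 * (A * B) ≤ A ^ 2 / Y + Y * B ^ 2 := by
    have : A ^ 2 / Y + Y * B ^ 2 - 2 * (A * B) = (A - Y * B) ^ 2 / Y := by field_simp; ring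
    have h0 : 0 ≤ (A - Y * B) ^ 2 / Y := by positivity
    linarith
  have hQ0 : 0 ≤ A ^ 2 / Y := by positivity
  have hQ1 : 0 ≤ Y * B ^ 2 := by positivity
  have e1 : (2 * (J - ρ₁ * I - Y ^ 2 * I - X * A ^ 2) * Y - A ^ 2 * (ρ₂ - 2 * X * Y)) / Y ^ 2 +
      ((ρ₂ - 2 * X * Y) * B ^ 2 + Y * (2 * (I + X * B ^ 2))) =
      2 / Y * (J - ρ₁ * I) + ρ₂ / Y * (Y * B ^ 2 - A ^ 2 / Y) := by
    field_simp
    ring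
  rw [e1]
  have e2 : ρ₂ / Y * (Y * B ^ 2 - A ^ 2 / Y) ≤ |ρ₂| / Y * (A ^ 2 / Y + Y * B ^ 2) := by
    refine (le_abs_self _).trans ?_
    rw [abs_mul, abs_div, abs_of_pos hy]
    refine mul_le_mul_of_nonneg_left ?_ (by positivity)
    rw [abs_le]; constructor <;> linarith
  have e3 : 2 / Y * (J - ρ₁ * I) ≤ (|ρ₁| + η) / Y * (A ^ 2 / Y + Y * B ^ 2) := by
    have h4 : (|ρ₁| + η) * (2 * (A * B)) ≤ (|ρ₁| + η) * (A ^ 2 / Y + Y * B ^ 2) :=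
      mul_le_mul_of_nonneg_left hAB (by positivity)
    calc 2 / Y * (J - ρ₁ * I) ≤ 2 / Y * ((|ρ₁| + η) * (A * B)) :=
          mul_le_mul_of_nonneg_left hin (by positivity)
      _ = ((|ρ₁| + η) * (2 * (A * B))) / Y := by ring
      _ ≤ ((|ρ₁| + η) * (A ^ 2 / Y + Y * B ^ 2)) / Y := by gcongr
      _ = _ := by ring
  calc _ ≤ (|ρ₁| + η) / Y * (A ^ 2 / Y + Y * B ^ 2) + |ρ₂| / Y * (A ^ 2 / Y + Y * B ^ 2) :=
        add_le_add e3 e2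
    _ = _ := by ring

theorem mul_modifiedEnergy_le {B r x y : ℝ} (hB : 1 ≤ B) (hr : 0 < r) (hy : r / B ≤ y)
    (hy' : y ≤ B * r) (hx : |x| ≤ B * r) (w v : H) :
    r * modifiedEnergy x y w v ≤ 3 * B ^ 3 * (‖v‖ ^ 2 + r ^ 2 * ‖w‖ ^ 2) := by
  have hB0 : 0 < B := by linarith
  have hy0 : 0 < y := lt_of_lt_of_le (by positivity) hy
  have h1 : ‖v - x • w‖ ^ 2 ≤ 2 * ‖v‖ ^ 2 + 2 * (B ^ 2 * r ^ 2) * ‖w‖ ^ 2 := by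
    have hn : ‖v - x • w‖ ≤ ‖v‖ + B * r * ‖w‖ := by
      refine (norm_sub_le _ _).trans ?_
      rw [norm_smul]
      gcongr
      exact hx
    have : ‖v - x • w‖ ^ 2 ≤ (‖v‖ + B * r * ‖w‖) ^ 2 := pow_le_pow_left₀ (norm_nonneg _) hn 2
    nlinarith [sq_nonneg (‖v‖ - B * r * ‖w‖)]
  have h2 : r * (‖v - x • w‖ ^ 2 / y) ≤ B * ‖v - x • w‖ ^ 2 := by
    rw [mul_div_assoc', div_le_iff₀ hy0]
    have : r ≤ y * B := (div_le_iff₀ hB0).1 hy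
    nlinarith [sq_nonneg ‖v - x • w‖]
  have h3 : r * (y * ‖w‖ ^ 2) ≤ B * (r ^ 2 * ‖w‖ ^ 2) := by
    nlinarith [mul_nonneg hr.le (sq_nonneg ‖w‖)]
  have hB2 : B ≤ B ^ 3 := by nlinarith [mul_nonneg hB0.le (by nlinarith : 0 ≤ B ^ 2 - 1)]
  have hV : 0 ≤ ‖v‖ ^ 2 := by positivity
  have hW : 0 ≤ r ^ 2 * ‖w‖ ^ 2 := by positivity
  have h4 := mul_le_mul_of_nonneg_left h1 hB0.le
  rw [modifiedEnergy, mul_add]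
  nlinarith [mul_le_mul_of_nonneg_right hB2 hV, mul_le_mul_of_nonneg_right hB2 hW]

theorem le_mul_modifiedEnergy {B r x y : ℝ} (hB : 1 ≤ B) (hr : 0 < r) (hy : r / B ≤ y)
    (hy' : y ≤ B * r) (hx : |x| ≤ B * r) (w v : H) :
    ‖v‖ ^ 2 + r ^ 2 * ‖w‖ ^ 2 ≤ 5 * B ^ 3 * (r * modifiedEnergy x y w v) := by
  have hB0 : 0 < B := by linarith
  have hy0 : 0 < y := lt_of_lt_of_le (by positivity) hy
  set Q := modifiedEnergy x y w v with hQ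
  have hQ0 : 0 ≤ Q := by rw [hQ, modifiedEnergy]; positivity
  have hw : r * ‖w‖ ^ 2 ≤ B * Q := by
    have h1 : y * ‖w‖ ^ 2 ≤ Q := by
      rw [hQ, modifiedEnergy]; exact le_add_of_nonneg_left (by positivity)
    have h2 : r ≤ y * B := (div_le_iff₀ hB0).1 hy
    nlinarith [sq_nonneg ‖w‖, mul_le_mul_of_nonneg_right h2 (sq_nonneg ‖w‖)]
  have hZ : ‖v - x • w‖ ^ 2 ≤ B * r * Q := by
    have h1 : ‖v - x • w‖ ^ 2 / y ≤ Q := by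
      rw [hQ, modifiedEnergy]; exact le_add_of_nonneg_right (by positivity)
    rw [div_le_iff₀ hy0] at h1
    nlinarith
  have hv : ‖v‖ ^ 2 ≤ 2 * ‖v - x • w‖ ^ 2 + 2 * (B ^ 2 * r ^ 2) * ‖w‖ ^ 2 := by
    have hn : ‖v‖ ≤ ‖v - x • w‖ + B * r * ‖w‖ := by
      calc ‖v‖ = ‖(v - x • w) + x • w‖ := by rw [sub_add_cancel]
        _ ≤ _ := by
          refine (norm_add_le _ _).trans ?_
          rw [norm_smul]
          gcongr
          exact hx
    have : ‖v‖ ^ 2 ≤ (‖v - x • w‖ + B * r * ‖w‖) ^ 2 := pow_le_pow_left₀ (norm_nonneg _) hn 2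
    nlinarith [sq_nonneg (‖v - x • w‖ - B * r * ‖w‖)]
  have hrw : r ^ 2 * ‖w‖ ^ 2 ≤ B * (r * Q) := by nlinarith
  have hBw : B ^ 2 * (r ^ 2 * ‖w‖ ^ 2) ≤ B ^ 3 * (r * Q) := by
    nlinarith [mul_le_mul_of_nonneg_left hrw (sq_nonneg B)]
  have hB2 : B ≤ B ^ 3 := by nlinarith [mul_nonneg hB0.le (by nlinarith : 0 ≤ B ^ 2 - 1)]
  have hrQ : 0 ≤ r * Q := by positivity
  nlinarith [mul_le_mul_of_nonneg_right hB2 hrQ]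

/-- While `y` is comparable to `r` and `|x| ≤ B r`, `r` times the modified energy is comparable to
the ordinary energy; the factor `15 B⁶` is the product of the two comparison constants `5 B³` and `3
B³`. -/
theorem energy_growth {B r s t η : ℝ} (hB : 1 ≤ B) (hr : 0 < r) (hs : 0 ≤ s) (hst : s ≤ t)
    {w v v' : ℝ → H} {x y x' y' c K k : ℝ → ℝ}
    (hw : ∀ τ, 0 ≤ τ → HasDerivWithinAt w (v τ) (Ici 0) τ)
    (hv : ∀ τ, 0 ≤ τ → HasDerivWithinAt v (v' τ) (Ici 0) τ)
    (hx : ∀ τ, 0 ≤ τ → HasDerivWithinAt x (x' τ) (Ici 0) τ)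
    (hy : ∀ τ, 0 ≤ τ → HasDerivWithinAt y (y' τ) (Ici 0) τ)
    (hK : ∀ τ, 0 ≤ τ → HasDerivWithinAt K (k τ) (Ici 0) τ) (hη0 : 0 ≤ η)
    (hη : ∀ τ ∈ Icc s t, ‖v' τ + c τ • w τ‖ ≤ η * ‖w τ‖)
    (hyl : ∀ τ ∈ Icc s t, r / B ≤ y τ) (hyu : ∀ τ ∈ Icc s t, y τ ≤ B * r)
    (hxb : ∀ τ ∈ Icc s t, |x τ| ≤ B * r)
    (hk : ∀ τ ∈ Icc s t, (|x' τ + x τ ^ 2 - y τ ^ 2 + c τ| + |y' τ + 2 * x τ * y τ| + η) / y τ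
      ≤ k τ) :
    ‖v t‖ ^ 2 + r ^ 2 * ‖w t‖ ^ 2 ≤
      15 * B ^ 6 * Real.exp (K t - K s) * (‖v s‖ ^ 2 + r ^ 2 * ‖w s‖ ^ 2) := by
  have hypos : ∀ τ ∈ Icc s t, 0 < y τ := fun τ hτ =>
    lt_of_lt_of_le (by positivity) (hyl τ hτ)
  have hsub : Icc s t ⊆ Ici (0 : ℝ) := fun τ hτ => hs.trans hτ.1
  have hat : ∀ {E : Type _} [NormedAddCommGroup E] [NormedSpace ℝ E] {f : ℝ → E} {f' : E} {τ : ℝ},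
      τ ∈ Ioo s t → HasDerivWithinAt f f' (Ici 0) τ → HasDerivAt f f' τ :=
    fun hτ h => h.hasDerivAt (Ici_mem_nhds (hs.trans_lt hτ.1))
  have hcont : ∀ {E : Type _} [NormedAddCommGroup E] [NormedSpace ℝ E] {f f' : ℝ → E},
      (∀ τ, 0 ≤ τ → HasDerivWithinAt f (f' τ) (Ici 0) τ) → ContinuousOn f (Icc s t) :=
    fun h τ hτ => ((h τ (hsub hτ)).continuousWithinAt).mono hsub
  have hcont' : ∀ {f f' : ℝ → ℝ},
      (∀ τ, 0 ≤ τ → HasDerivWithinAt f (f' τ) (Ici 0) τ) → ContinuousOn f (Icc s t) :=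
    fun h τ hτ => ((h τ (hsub hτ)).continuousWithinAt).mono hsub
  have hat' : ∀ {f : ℝ → ℝ} {f' : ℝ} {τ : ℝ},
      τ ∈ Ioo s t → HasDerivWithinAt f f' (Ici 0) τ → HasDerivAt f f' τ :=
    fun hτ h => h.hasDerivAt (Ici_mem_nhds (hs.trans_lt hτ.1))
  have hmod : ∀ τ ∈ Ioo s t, _ := fun τ hτ =>
    modifiedEnergy_deriv_le (hypos τ ⟨hτ.1.le, hτ.2.le⟩) (hat hτ (hw τ (hs.trans hτ.1.le)))
      (hat hτ (hv τ (hs.trans hτ.1.le))) (hat' hτ (hx τ (hs.trans hτ.1.le)))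
      (hat' hτ (hy τ (hs.trans hτ.1.le))) hη0 (hη τ ⟨hτ.1.le, hτ.2.le⟩)
  choose! Q' hQ' hQle using hmod
  set Q := fun τ => modifiedEnergy (x τ) (y τ) (w τ) (v τ) with hQ
  have hQ0 : ∀ τ ∈ Icc s t, 0 ≤ Q τ := fun τ hτ => by
    have := hypos τ hτ
    simp only [hQ, modifiedEnergy]; positivity
  have hQc : ContinuousOn Q (Icc s t) := by
    have h1 := hcont hw
    have h2 := hcont hv
    have h3 := hcont' hx
    have h4 := hcont' hy
    exact (((h2.sub (h3.smul h1)).norm.pow 2).div h4 fun τ hτ => (hypos τ hτ).ne').add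
      (h4.mul (h1.norm.pow 2))
  have hgr := le_mul_exp_of_deriv_le hst hQc (hcont' hK) hQ'
    (fun τ hτ => hat' hτ (hK τ (hs.trans hτ.1.le))) fun τ hτ => (hQle τ hτ).trans
      (mul_le_mul_of_nonneg_right (hk τ ⟨hτ.1.le, hτ.2.le⟩) (hQ0 τ ⟨hτ.1.le, hτ.2.le⟩))
  have hls : s ∈ Icc s t := left_mem_Icc.2 hst
  have hrt : t ∈ Icc s t := right_mem_Icc.2 hst
  calc ‖v t‖ ^ 2 + r ^ 2 * ‖w t‖ ^ 2 ≤ 5 * B ^ 3 * (r * Q t) :=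
        le_mul_modifiedEnergy hB hr (hyl t hrt) (hyu t hrt) (hxb t hrt) _ _
    _ ≤ 5 * B ^ 3 * (r * (Q s * Real.exp (K t - K s))) := by gcongr
    _ = 5 * B ^ 3 * Real.exp (K t - K s) * (r * Q s) := by ring
    _ ≤ 5 * B ^ 3 * Real.exp (K t - K s) * (3 * B ^ 3 * (‖v s‖ ^ 2 + r ^ 2 * ‖w s‖ ^ 2)) :=
        mul_le_mul_of_nonneg_left
          (mul_modifiedEnergy_le hB hr (hyl s hls) (hyu s hls) (hxb s hls) _ _) (by positivity)
    _ = _ := by ring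

/-! ### Energy growth in the two zones of the time-frequency plane -/

/-- `w' = v` and `|w'' + a² r² w| ≤ δ r² |w|` on `[0, T]`. -/
structure IsApproxOscillator {H : Type*} [NormedAddCommGroup H] [InnerProductSpace ℝ H]
    (a : ℝ → ℝ) (r δ T : ℝ) (w v v' : ℝ → H) : Prop where
  deriv_fst : ∀ t, 0 ≤ t → HasDerivWithinAt w (v t) (Ici 0) t
  deriv_snd : ∀ t, 0 ≤ t → HasDerivWithinAt v (v' t) (Ici 0) t
  bound : ∀ t ∈ Icc 0 T, ‖v' t + (a t ^ 2 * r ^ 2) • w t‖ ≤ δ * r ^ 2 * ‖w t‖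

theorem IsApproxOscillator.mono {H : Type*} [NormedAddCommGroup H] [InnerProductSpace ℝ H]
    {a : ℝ → ℝ} {r δ T T' : ℝ} {w v v' : ℝ → H} (h : IsApproxOscillator a r δ T w v v')
    (hT : T' ≤ T) : IsApproxOscillator a r δ T' w v v' :=
  ⟨h.deriv_fst, h.deriv_snd, fun t ht => h.bound t ⟨ht.1, ht.2.trans hT⟩⟩

/-- The comparison frequency is the constant `i a_∞ r`; its Riccati residual is `(a² - a_∞²) r²`, so
the growth rate is a multiple of `r |a - a_∞|`. The frequency error adds `δ r T / a_∞`, which the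
bounds on `r` and `δ (1 + T)` turn into a constant. -/
theorem pseudoDifferential_zone_estimate {p : ℝ} {a : ℝ → ℝ} (ha : BoundedSpeed a)
    (hac : ContinuousOn a (Ici 0)) {aInf L R D : ℝ} (haInf : 0 < aInf) (hL0 : 0 ≤ L)
    (hL : ∀ t : ℝ, 0 ≤ t → ∫ s in (0 : ℝ)..t, |a s - aInf| ≤ L * (1 + t) ^ (1 - p)) :
    ∃ C c : ℝ, 0 < C ∧ 0 < c ∧ ∀ (H : Type) [NormedAddCommGroup H] [InnerProductSpace ℝ H]
      (r δ T : ℝ) (w v v' : ℝ → H), 0 < r → r ≤ R → 0 ≤ T → 0 ≤ δ → δ * (1 + T) ≤ D →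
      IsApproxOscillator a r δ T w v v' →
      ‖v T‖ ^ 2 + r ^ 2 * ‖w T‖ ^ 2 ≤
        C * Real.exp (c * (r * (1 + T) ^ (1 - p))) * (‖v 0‖ ^ 2 + r ^ 2 * ‖w 0‖ ^ 2) := by
  obtain ⟨a₀, a₁, ha₀, ha₁, hab⟩ := ha
  set B : ℝ := 1 + aInf + aInf⁻¹ with hBdef
  have hinv : 0 < aInf⁻¹ := by positivity
  have hB : 1 ≤ B := by linarith
  set c₁ : ℝ := (a₁ + aInf) / aInf with hc₁
  refine ⟨15 * B ^ 6 * Real.exp (R * |D| / aInf), c₁ * L + 1, by positivity, by positivity, ?_⟩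
  intro H _ _ r δ T w v v' hr hrR hT hδ hδT hosc
  -- Nothing is known about `a` at negative times; freezing it there makes the integrand continuous
  -- on the whole line, and the primitive is then differentiable at `0` as well.
  set f : ℝ → ℝ := fun s => |a (max s 0) - aInf| with hf
  have hfc : Continuous f := by
    have h1 : Continuous fun s : ℝ => a (max s 0) :=
      hac.comp_continuous (by fun_prop) fun s => mem_Ici.2 (le_max_right s 0)
    exact (h1.sub continuous_const).abs
  have hfint : ∀ t, 0 ≤ t → ∫ s in (0 : ℝ)..t, f s ≤ L * (1 + t) ^ (1 - p) := by
    intro t ht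
    refine le_trans (le_of_eq ?_) (hL t ht)
    refine intervalIntegral.integral_congr fun s hs => ?_
    rw [uIcc_of_le ht] at hs
    simp only [hf]
    rw [max_eq_left hs.1]
  set K : ℝ → ℝ := fun t => c₁ * r * (∫ s in (0 : ℝ)..t, f s) + δ * r / aInf * t with hK
  have hKd : ∀ τ, 0 ≤ τ → HasDerivWithinAt K (c₁ * r * f τ + δ * r / aInf) (Ici 0) τ := by
    intro τ _
    have h1 := (hfc.integral_hasStrictDerivAt 0 τ).hasDerivAt.const_mul (c₁ * r)
    have h2 := (hasDerivAt_id τ).const_mul (δ * r / aInf)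
    exact (h1.add h2).hasDerivWithinAt.congr_deriv (by simp)
  have hg := energy_growth (x := fun _ => 0) (x' := fun _ => 0) (y := fun _ => aInf * r)
    (y' := fun _ => 0) (c := fun t => a t ^ 2 * r ^ 2) (η := δ * r ^ 2) hB hr le_rfl hT
    hosc.deriv_fst hosc.deriv_snd (fun _ _ => hasDerivWithinAt_const _ _ _)
    (fun _ _ => hasDerivWithinAt_const _ _ _) hKd (by positivity) hosc.bound
    (fun τ _ => by
      rw [div_le_iff₀ (by positivity)]
      have : 1 ≤ aInf * B := by
        rw [hBdef, mul_add, mul_inv_cancel₀ haInf.ne']; nlinarith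
      nlinarith)
    (fun τ _ => mul_le_mul_of_nonneg_right (by linarith) hr.le)
    (fun τ _ => by simp only [abs_zero]; positivity)
    (fun τ hτ => by
      obtain ⟨h1, h2⟩ := hab τ hτ.1
      simp only [hf, max_eq_left hτ.1]
      have e1 : (0 : ℝ) + 0 ^ 2 - (aInf * r) ^ 2 + a τ ^ 2 * r ^ 2 =
          (a τ - aInf) * (a τ + aInf) * r ^ 2 := by ring
      have e2 : (0 : ℝ) + 2 * 0 * (aInf * r) = 0 := by ring
      rw [e1, e2, abs_mul, abs_mul, abs_zero, abs_of_pos (by positivity : 0 < r ^ 2),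
        abs_of_pos (by linarith : 0 < a τ + aInf), div_le_iff₀ (by positivity)]
      have e3 : (c₁ * r * |a τ - aInf| + δ * r / aInf) * (aInf * r) =
          |a τ - aInf| * (a₁ + aInf) * r ^ 2 + δ * r ^ 2 := by
        rw [hc₁]; field_simp
      rw [e3, add_zero]
      gcongr)
  refine hg.trans ?_
  have hK0 : K 0 = 0 := by simp [hK]
  have hKT : K T ≤ R * |D| / aInf + (c₁ * L + 1) * (r * (1 + T) ^ (1 - p)) := by
    have h1 : c₁ * r * (∫ s in (0 : ℝ)..T, f s) ≤ c₁ * r * (L * (1 + T) ^ (1 - p)) :=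
      mul_le_mul_of_nonneg_left (hfint T hT) (by positivity)
    have h2 : δ * r / aInf * T ≤ R * |D| / aInf := by
      have h3 : δ * T ≤ |D| := le_trans (by nlinarith) (hδT.trans (le_abs_self D))
      have h4 : r * (δ * T) ≤ R * |D| :=
        mul_le_mul hrR h3 (mul_nonneg hδ hT) (hr.le.trans hrR)
      rw [div_mul_eq_mul_div, show δ * r * T = r * (δ * T) by ring]
      exact div_le_div_of_nonneg_right h4 haInf.le
    have h4 : 0 ≤ r * (1 + T) ^ (1 - p) := by positivity
    calc K T ≤ c₁ * r * (L * (1 + T) ^ (1 - p)) + R * |D| / aInf := add_le_add h1 h2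
      _ ≤ _ := by nlinarith
  rw [hK0, sub_zero]
  have := Real.exp_le_exp.2 hKT
  rw [Real.exp_add (R * |D| / aInf)] at this
  calc _ ≤ 15 * B ^ 6 * (Real.exp (R * |D| / aInf) *
        Real.exp ((c₁ * L + 1) * (r * (1 + T) ^ (1 - p)))) * (‖v 0‖ ^ 2 + r ^ 2 * ‖w 0‖ ^ 2) := by
        gcongr
    _ = _ := by ring

theorem riccati_rate_le {a₀ r δ C P y : ℝ} {Z : ℂ} (ha₀ : 0 < a₀) (hr : 0 < r) (hδ : 0 ≤ δ)
    (hZ : ‖Z‖ ≤ C * P) (hy : a₀ / 2 ≤ y) :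
    (|r ^ 2 * Z.re| + |r ^ 2 * Z.im| + δ * r ^ 2) / (r * y) ≤
      4 * C / a₀ * r * P + 2 * δ * r / a₀ := by
  have h4 := (Complex.abs_re_le_norm Z).trans hZ
  have h5 := (Complex.abs_im_le_norm Z).trans hZ
  have h0 : 0 ≤ C * P := (norm_nonneg _).trans hZ
  have hr2 : 0 < r ^ 2 := by positivity
  rw [abs_mul, abs_mul, abs_of_pos hr2]
  calc (r ^ 2 * |Z.re| + r ^ 2 * |Z.im| + δ * r ^ 2) / (r * y)
      ≤ (r ^ 2 * (C * P) + r ^ 2 * (C * P) + δ * r ^ 2) / (r * (a₀ / 2)) := by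
        refine div_le_div₀ (by positivity) ?_ (by positivity)
          (mul_le_mul_of_nonneg_left hy hr.le)
        gcongr
    _ = _ := by field_simp; ring

/-- With `S = p + m (1 - q) > 1`, the integral of `r^{1-m} (1 + τ)^{-S}` over `[s, T]` is controlled
by its endpoint `s`; the term at `T` has a favourable sign. That endpoint term is a multiple of `r
(1 + s)^{1-p} · (r (1 + s)^{1-q})^{-m}`, and the last factor is at most `1`. -/
theorem riccati_exponent_le {a₀ C p q R D r δ s T : ℝ} {m : ℕ} (ha₀ : 0 < a₀) (hC₂ : 0 ≤ C)
    (hpm : 1 < p + m * (1 - q)) (hr : 0 < r) (hrR : r ≤ R) (hs : 0 ≤ s) (hsT : s ≤ T)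
    (hδ : 0 ≤ δ) (hδT : δ * (1 + T) ≤ D) (hN : 1 ≤ r * (1 + s) ^ (1 - q)) :
    4 * C / a₀ * r * (r ^ m)⁻¹ *
          (-((1 + T) ^ (1 - (p + m * (1 - q))) / (p + m * (1 - q) - 1))) + 2 * δ * r / a₀ * T -
        (4 * C / a₀ * r * (r ^ m)⁻¹ *
          (-((1 + s) ^ (1 - (p + m * (1 - q))) / (p + m * (1 - q) - 1))) + 2 * δ * r / a₀ * s) ≤
      2 * (R * |D| / a₀) +
      (4 * C / (a₀ * (p + m * (1 - q) - 1)) + 1) * (r * (1 + s) ^ (1 - p)) := by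
  have hT : 0 ≤ T := hs.trans hsT
  set S : ℝ := p + m * (1 - q) with hS
  set A : ℝ := 4 * C / a₀ * r * (r ^ m)⁻¹ with hA
  have hA0 : 0 ≤ A := by positivity
  have h1 : 0 ≤ A * ((1 + T) ^ (1 - S) / (S - 1)) :=
    mul_nonneg hA0 (div_nonneg (by positivity) (by linarith))
  have h2 : 2 * δ * r / a₀ * T - 2 * δ * r / a₀ * s ≤ 2 * (R * |D| / a₀) := by
    have h3 : δ * T ≤ |D| := le_trans (by nlinarith) (hδT.trans (le_abs_self D))
    have h4 : 0 ≤ 2 * δ * r / a₀ * s := by positivity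
    have h5 : r * (δ * T) ≤ R * |D| := by
      exact mul_le_mul hrR h3 (mul_nonneg hδ (hs.trans hsT)) (hr.le.trans hrR)
    have h6 : 2 * δ * r / a₀ * T = 2 * (r * (δ * T) / a₀) := by ring
    rw [h6]
    have : r * (δ * T) / a₀ ≤ R * |D| / a₀ := div_le_div_of_nonneg_right h5 ha₀.le
    linarith
  have h7 : A * ((1 + s) ^ (1 - S) / (S - 1)) ≤
      4 * C / (a₀ * (S - 1)) * (r * (1 + s) ^ (1 - p)) := by
    have e1 : (1 + s) ^ (1 - S) = (1 + s) ^ (1 - p) * (((1 + s) ^ (1 - q)) ^ m)⁻¹ := by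
      rw [← Real.rpow_natCast, ← Real.rpow_mul (by positivity), ← Real.rpow_neg (by positivity),
        ← Real.rpow_add (by positivity)]
      congr 1
      rw [hS]; ring
    have hge : 1 ≤ (r * (1 + s) ^ (1 - q)) ^ m := one_le_pow₀ hN
    have hle : ((r * (1 + s) ^ (1 - q)) ^ m)⁻¹ ≤ 1 := inv_le_one_of_one_le₀ hge
    have hS1 : 0 < S - 1 := by linarith
    calc A * ((1 + s) ^ (1 - S) / (S - 1)) = 4 * C / (a₀ * (S - 1)) * (r * (1 + s) ^ (1 - p)) *
          ((r * (1 + s) ^ (1 - q)) ^ m)⁻¹ := by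
          rw [e1, hA, mul_pow, mul_inv]; field_simp
      _ ≤ _ := mul_le_of_le_one_right (by positivity) hle
  have h8 : 0 ≤ r * (1 + s) ^ (1 - p) := by positivity
  have h9 : A * ((1 + T) ^ (1 - S) / (S - 1)) = -(A * (-((1 + T) ^ (1 - S) / (S - 1)))) := by ring
  linarith

/-- The comparison frequency is `r ζ` with the approximate Riccati solution `ζ`. Since `Ξ ≥ (1 +
t)^{1-q}`, the condition at time `s` persists at all later times. -/
theorem hyperbolic_zone_estimate {m : ℕ} (hm : 1 ≤ m) {p q : ℝ} (hp : 0 ≤ p)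
    {a Ξ : ℝ → ℝ} (ha : BoundedSpeed a)
    (hΞ : ∀ t : ℝ, 0 ≤ t → Ξ t = (1 + t) ^ (p / m - q + 1))
    (hosc : OscillationBound a Ξ m) (hpm : 1 < p + m * (1 - q)) {R D : ℝ} :
    ∃ N C c : ℝ, 1 ≤ N ∧ 0 < C ∧ 0 < c ∧
      ∀ (H : Type) [NormedAddCommGroup H] [InnerProductSpace ℝ H]
      (r δ s T : ℝ) (w v v' : ℝ → H), 0 < r → r ≤ R → 0 ≤ s → s ≤ T → 0 ≤ δ →
      δ * (1 + T) ≤ D → N ≤ r * (1 + s) ^ (1 - q) → q ≤ 1 →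
      IsApproxOscillator a r δ T w v v' →
      ‖v T‖ ^ 2 + r ^ 2 * ‖w T‖ ^ 2 ≤
        C * Real.exp (c * (r * (1 + s) ^ (1 - p))) * (‖v s‖ ^ 2 + r ^ 2 * ‖w s‖ ^ 2) := by
  have hm0 : (0 : ℝ) < m := by exact_mod_cast hm
  have hX : ∀ t : ℝ, 0 ≤ t → 0 < Ξ t := fun t ht => by
    rw [hΞ t ht]; positivity
  have hXpow : ∀ t : ℝ, 0 ≤ t → Ξ t ^ m = (1 + t) ^ (p + m * (1 - q)) := fun t ht => by
    rw [hΞ t ht, ← Real.rpow_natCast, ← Real.rpow_mul (by positivity)]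
    congr 1
    field_simp
    ring
  have hXΛ : ∀ t : ℝ, 0 ≤ t → (1 + t) ^ (1 - q) ≤ Ξ t := fun t ht => by
    rw [hΞ t ht]
    refine Real.rpow_le_rpow_of_exponent_le (by linarith) ?_
    have : 0 ≤ p / m := by positivity
    linarith
  obtain ⟨ζ, ζ', hd, ⟨C₁, hC₁, hζ⟩, ⟨C₂, hC₂, hRic⟩⟩ := exists_approx_riccati hm hX ha hosc
  obtain ⟨a₀, a₁, ha₀, ha₁, hab⟩ := ha
  set S : ℝ := p + m * (1 - q) with hS
  set B : ℝ := 1 + 2 * a₁ + 2 * a₀⁻¹ + a₀ with hBdef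
  have hinv : 0 < a₀⁻¹ := by positivity
  have hB : 1 ≤ B := by linarith
  -- The threshold for `r (1 + s)^{1-q}` has two purposes: the `1` puts the whole interval in the
  -- symbol zone, and `2 C₁ / a₀` forces `|ζ - i a| ≤ a₀ / 2`, so that `Im ζ ≥ a₀ / 2`.
  refine ⟨1 + 2 * C₁ / a₀, 15 * B ^ 6 * Real.exp (2 * (R * |D| / a₀)),
    4 * C₂ / (a₀ * (S - 1)) + 1, ?_, by positivity, ?_, ?_⟩
  · have : 0 ≤ 2 * C₁ / a₀ := by positivity
    linarith
  · have : 0 ≤ 4 * C₂ / (a₀ * (S - 1)) :=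
      div_nonneg (by positivity) (mul_nonneg ha₀.le (by linarith))
    linarith
  intro H _ _ r δ s T w v v' hr hrR hs hsT hδ hδT hN hq hw
  have hzone : ∀ t, s ≤ t → 1 + 2 * C₁ / a₀ ≤ r * Ξ t := fun t ht => by
    refine hN.trans (mul_le_mul_of_nonneg_left ?_ hr.le)
    refine le_trans ?_ (hXΛ t (hs.trans ht))
    exact Real.rpow_le_rpow (by positivity) (by linarith) (by linarith)
  have hC₁a : 0 ≤ 2 * C₁ / a₀ := by positivity
  have hzone1 : ∀ t, s ≤ t → 1 ≤ r * Ξ t := fun t ht => by linarith [hzone t ht]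
  have hσ : ∀ t, s ≤ t → ‖ζ r t - Complex.I * a t‖ ≤ a₀ / 2 := fun t ht => by
    refine (hζ r t hr (hs.trans ht) (hzone1 t ht)).trans ?_
    have h1 := hzone t ht
    have h0 : 0 < r * Ξ t := by linarith
    rw [pow_one, pow_one, ← mul_inv, ← div_eq_mul_inv, div_le_iff₀ h0]
    have h2 : 2 * C₁ / a₀ ≤ r * Ξ t := by linarith
    rw [div_le_iff₀ ha₀] at h2
    linarith
  have hre : ∀ t, s ≤ t → |(ζ r t).re| ≤ a₀ / 2 := fun t ht => by
    have := (Complex.abs_re_le_norm _).trans (hσ t ht)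
    simpa using this
  have him : ∀ t, s ≤ t → |(ζ r t).im - a t| ≤ a₀ / 2 := fun t ht => by
    have := (Complex.abs_im_le_norm _).trans (hσ t ht)
    simpa using this
  have hdre : ∀ τ, 0 ≤ τ →
      HasDerivWithinAt (fun τ => r * (ζ r τ).re) (r * (ζ' r τ).re) (Ici 0) τ := fun τ hτ =>
    ((Complex.reCLM.hasFDerivAt.comp_hasDerivWithinAt τ (hd r τ hr hτ))).const_mul r
  have hdim : ∀ τ, 0 ≤ τ →
      HasDerivWithinAt (fun τ => r * (ζ r τ).im) (r * (ζ' r τ).im) (Ici 0) τ := fun τ hτ =>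
    ((Complex.imCLM.hasFDerivAt.comp_hasDerivWithinAt τ (hd r τ hr hτ))).const_mul r
  set A : ℝ := 4 * C₂ / a₀ * r * (r ^ m)⁻¹ with hA
  have hA0 : 0 ≤ A := by positivity
  set K : ℝ → ℝ := fun t => A * (-((1 + t) ^ (1 - S) / (S - 1))) + 2 * δ * r / a₀ * t with hK
  have hKd : ∀ τ, 0 ≤ τ → HasDerivWithinAt K (A * (1 + τ) ^ (-S) + 2 * δ * r / a₀) (Ici 0) τ := by
    intro τ hτ
    have h1 : HasDerivAt (fun t : ℝ => (1 + t) ^ (1 - S)) ((1 - S) * (1 + τ) ^ (-S)) τ := by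
      have := ((hasDerivAt_id τ).const_add 1).rpow_const (p := 1 - S)
        (Or.inl (by simp only [id]; linarith))
      convert! this using 1
      simp only [id]
      rw [show 1 - S - 1 = -S by ring]
      ring
    have h2 := (((h1.div_const (S - 1)).neg).const_mul A).add
      ((hasDerivAt_id τ).const_mul (2 * δ * r / a₀))
    refine (h2.congr_deriv ?_).hasDerivWithinAt
    have : S - 1 ≠ 0 := by linarith
    field_simp
    ring
  have hg := energy_growth (c := fun t => a t ^ 2 * r ^ 2) (η := δ * r ^ 2) hB hr hs hsT
    hw.deriv_fst hw.deriv_snd hdre hdim hKd (by positivity)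
    (fun τ hτ => hw.bound τ ⟨hs.trans hτ.1, hτ.2⟩)
    (fun τ hτ => by
      have h1 := abs_le.1 (him τ hτ.1)
      have h2 := (hab τ (hs.trans hτ.1)).1
      rw [div_le_iff₀ (by positivity)]
      have h3 : a₀ / 2 ≤ (ζ r τ).im := by linarith
      have h4 : 1 ≤ a₀ / 2 * B := by
        have : a₀ / 2 * (2 * a₀⁻¹) = 1 := by field_simp
        rw [hBdef]; nlinarith
      have h5 : 1 ≤ (ζ r τ).im * B := h4.trans (mul_le_mul_of_nonneg_right h3 (by linarith))
      nlinarith)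
    (fun τ hτ => by
      have h1 := abs_le.1 (him τ hτ.1)
      have h2 := (hab τ (hs.trans hτ.1)).2
      rw [mul_comm]
      exact mul_le_mul_of_nonneg_right (by linarith) hr.le)
    (fun τ hτ => by
      rw [abs_mul, abs_of_pos hr, mul_comm]
      exact mul_le_mul_of_nonneg_right ((hre τ hτ.1).trans (by linarith)) hr.le)
    (fun τ hτ => by
      have hτ0 := hs.trans hτ.1
      have h1 := abs_le.1 (him τ hτ.1)
      have h2 := (hab τ hτ0).1
      have h3 : a₀ / 2 ≤ (ζ r τ).im := by linarith
      set Z : ℂ := ζ' r τ / r + ζ r τ ^ 2 + (a τ : ℂ) ^ 2 with hZ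
      have hZb : ‖Z‖ ≤ C₂ * ((r ^ m)⁻¹ * (1 + τ) ^ (-S)) := by
        refine (hRic r τ hr hτ0 (hzone1 τ hτ.1)).trans (le_of_eq ?_)
        rw [hXpow τ hτ0, Real.rpow_neg (by linarith)]
      have hsq : ((a τ : ℂ) ^ 2) = ((a τ ^ 2 : ℝ) : ℂ) := by push_cast; rfl
      -- The two residuals for `x = r Re ζ`, `y = r Im ζ` are the real and imaginary parts of `r²
      -- Z`.
      have e1 : r * (ζ' r τ).re + (r * (ζ r τ).re) ^ 2 - (r * (ζ r τ).im) ^ 2 + a τ ^ 2 * r ^ 2 =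
          r ^ 2 * Z.re := by
        rw [hZ, hsq, sq (ζ r τ)]
        simp only [Complex.add_re, Complex.mul_re, Complex.ofReal_re, Complex.div_ofReal_re]
        field_simp
        ring
      have e2 : r * (ζ' r τ).im + 2 * (r * (ζ r τ).re) * (r * (ζ r τ).im) = r ^ 2 * Z.im := by
        rw [hZ, hsq, sq (ζ r τ)]
        simp only [Complex.add_im, Complex.mul_im, Complex.ofReal_im, Complex.div_ofReal_im]
        field_simp
        ring
      rw [e1, e2, hA, mul_assoc _ (r ^ m)⁻¹]
      exact riccati_rate_le ha₀ hr hδ hZb h3)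
  refine hg.trans ?_
  have hKT : K T - K s ≤ 2 * (R * |D| / a₀) +
      (4 * C₂ / (a₀ * (S - 1)) + 1) * (r * (1 + s) ^ (1 - p)) :=
    riccati_exponent_le ha₀ hC₂ hpm hr hrR hs hsT hδ hδT (by linarith)
  have := Real.exp_le_exp.2 hKT
  rw [Real.exp_add (2 * (R * |D| / a₀))] at this
  calc _ ≤ 15 * B ^ 6 * (Real.exp (2 * (R * |D| / a₀)) *
        Real.exp ((4 * C₂ / (a₀ * (S - 1)) + 1) * (r * (1 + s) ^ (1 - p)))) *
          (‖v s‖ ^ 2 + r ^ 2 * ‖w s‖ ^ 2) := by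
        gcongr
    _ = _ := by ring

/-- The zones meet where `r (1 + s)^{1-q} = M`. There `r (1 + s)^{1-p}`, the exponent of both zone
estimates, equals `M^κ r^{1-κ}` with `κ = (1 - p)/(1 - q)`, and `κ - 1 = (q - p)/(1 - q)`. -/
theorem oscillator_estimate {m : ℕ} (hm : 1 ≤ m) {p q : ℝ} (hp : 0 ≤ p) (hpq : p < q) (hq : q < 1)
    {a Ξ : ℝ → ℝ} (ha : BoundedSpeed a)
    (hΞ : ∀ t : ℝ, 0 ≤ t → Ξ t = (1 + t) ^ (p / m - q + 1))
    (hosc : OscillationBound a Ξ m) (hpm : 1 < p + m * (1 - q)) {aInf L : ℝ} (haInf : 0 < aInf)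
    (hL0 : 0 ≤ L)
    (hL : ∀ t : ℝ, 0 ≤ t → ∫ s in (0 : ℝ)..t, |a s - aInf| ≤ L * (1 + t) ^ (1 - p)) (R D : ℝ) :
    ∃ C c : ℝ, 0 < C ∧ 0 < c ∧
      ∀ (H : Type) [NormedAddCommGroup H] [InnerProductSpace ℝ H]
      (r δ T : ℝ) (w v v' : ℝ → H), 0 < r → r ≤ R → 0 ≤ T → 0 ≤ δ →
      δ * (1 + T) ≤ D → IsApproxOscillator a r δ T w v v' →
      ‖v T‖ ^ 2 + r ^ 2 * ‖w T‖ ^ 2 ≤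
        C * Real.exp (c * r ^ (-((q - p) / (1 - q)))) * (‖v 0‖ ^ 2 + r ^ 2 * ‖w 0‖ ^ 2) := by
  obtain ⟨C₁, c₁, hC₁, hc₁, h₁⟩ :=
    pseudoDifferential_zone_estimate (R := R) (D := D) ha hosc.1.continuousOn haInf hL0 hL
  obtain ⟨N, C₂, c₂, hN, hC₂, hc₂, h₂⟩ :=
    hyperbolic_zone_estimate (R := R) (D := D) hm hp ha hΞ hosc hpm
  have hq0 : 0 < 1 - q := by linarith
  -- `M ≥ N` makes the hyperbolic estimate applicable from `s` on, and `M ≥ R ≥ r` makes `s`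
  -- nonnegative.
  set M : ℝ := max N R with hM
  have hM1 : 1 ≤ M := hN.trans (le_max_left _ _)
  set κ : ℝ := (1 - p) / (1 - q) with hκ
  refine ⟨C₁ * (C₂ + 1), (c₁ + c₂) * M ^ κ, by positivity, by positivity, ?_⟩
  intro H _ _ r δ T w v v' hr hrR hT hδ hδT hw
  have hMr : 1 ≤ M / r := by
    rw [le_div_iff₀ hr, one_mul]; exact hrR.trans (le_max_right _ _)
  set s : ℝ := (M / r) ^ (1 / (1 - q)) - 1 with hs
  have hs1 : 1 + s = (M / r) ^ (1 / (1 - q)) := by rw [hs]; ring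
  have hs0 : 0 ≤ s := by
    have := Real.one_le_rpow hMr (by positivity : 0 ≤ 1 / (1 - q))
    rw [hs]; linarith
  have hsq : r * (1 + s) ^ (1 - q) = M := by
    rw [hs1, ← Real.rpow_mul (by positivity), one_div_mul_cancel hq0.ne', Real.rpow_one]
    field_simp
  have hsp : r * (1 + s) ^ (1 - p) = M ^ κ * r ^ (-((q - p) / (1 - q))) := by
    have e1 : -((q - p) / (1 - q)) = 1 + -κ := by rw [hκ]; field_simp; ring
    rw [hs1, ← Real.rpow_mul (by positivity), e1, Real.rpow_add hr, Real.rpow_one,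
      Real.rpow_neg hr.le, one_div_mul_eq_div, Real.div_rpow (by positivity) hr.le]
    ring
  have he0 : 0 ≤ ‖v 0‖ ^ 2 + r ^ 2 * ‖w 0‖ ^ 2 := by positivity
  set G : ℝ := M ^ κ * r ^ (-((q - p) / (1 - q))) with hG
  have hG0 : 0 ≤ G := by positivity
  have hfin : ∀ C c : ℝ, 0 ≤ C → C ≤ C₁ * (C₂ + 1) → c ≤ c₁ + c₂ →
      C * Real.exp (c * G) * (‖v 0‖ ^ 2 + r ^ 2 * ‖w 0‖ ^ 2) ≤ C₁ * (C₂ + 1) *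
        Real.exp ((c₁ + c₂) * M ^ κ * r ^ (-((q - p) / (1 - q)))) *
          (‖v 0‖ ^ 2 + r ^ 2 * ‖w 0‖ ^ 2) := by
    intro C c hC0 hC hc
    rw [mul_assoc (c₁ + c₂), ← hG]
    gcongr
  rcases le_total T s with hTs | hsT
  · refine (h₁ H r δ T w v v' hr hrR hT hδ hδT hw).trans ?_
    have h3 : r * (1 + T) ^ (1 - p) ≤ G := by
      rw [← hsp]
      exact mul_le_mul_of_nonneg_left
        (Real.rpow_le_rpow (by positivity) (by linarith) (by linarith)) hr.le
    refine le_trans ?_ (hfin C₁ c₁ hC₁.le (by nlinarith) (by linarith))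
    gcongr
  · have hδs : δ * (1 + s) ≤ D := le_trans (by gcongr) hδT
    have h3 := h₁ H r δ s w v v' hr hrR hs0 hδ hδs (hw.mono hsT)
    have h4 := h₂ H r δ s T w v v' hr hrR hs0 hsT hδ hδT
      (by rw [hsq]; exact le_max_left _ _) hq.le hw
    rw [hsp] at h3 h4
    refine le_trans (h4.trans (mul_le_mul_of_nonneg_left h3 (by positivity)))
      (le_trans (le_of_eq ?_) (hfin (C₂ * C₁) (c₂ + c₁) (by positivity) (by nlinarith)
        (by linarith)))
    rw [add_mul, Real.exp_add]
    ring

/-! ### The discrete-time Fourier transform -/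

/-- Lebesgue measure on the cube. -/
abbrev cubeMeasure (d : ℕ) : Measure (Fin d → ℝ) := volume.restrict (cube d)

instance (d : ℕ) : IsFiniteMeasure (cubeMeasure d) :=
  ⟨by rw [Measure.restrict_apply_univ]; exact isCompact_Icc.measure_lt_top⟩

/-- The character `θ ↦ e^{-i k·θ}`. -/
def expMode {d : ℕ} (k : Fin d → ℤ) (θ : Fin d → ℝ) : ℂ :=
  Complex.exp (-Complex.I * ((∑ j, (k j : ℝ) * θ j : ℝ) : ℂ))

theorem norm_expMode {d : ℕ} (k : Fin d → ℤ) (θ : Fin d → ℝ) : ‖expMode k θ‖ = 1 := by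
  rw [expMode, show -Complex.I * ((∑ j, (k j : ℝ) * θ j : ℝ) : ℂ) =
    ((-(∑ j, (k j : ℝ) * θ j) : ℝ) : ℂ) * Complex.I by push_cast; ring]
  exact Complex.norm_exp_ofReal_mul_I _

theorem expMode_add {d : ℕ} (k l : Fin d → ℤ) (θ : Fin d → ℝ) :
    expMode (k + l) θ = expMode k θ * expMode l θ := by
  rw [expMode, expMode, expMode, ← Complex.exp_add]
  congr 1
  rw [← mul_add, ← Complex.ofReal_add, ← Finset.sum_add_distrib]
  congr 2
  refine Finset.sum_congr rfl fun j _ => ?_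
  simp only [Pi.add_apply]
  push_cast
  ring

@[fun_prop]
theorem continuous_expMode {d : ℕ} (k : Fin d → ℤ) : Continuous (expMode k) := by
  unfold expMode
  fun_prop

theorem memLp_expMode {d : ℕ} (k : Fin d → ℤ) : MemLp (expMode k) 2 (cubeMeasure d) :=
  MemLp.of_bound (continuous_expMode k).aestronglyMeasurable 1
    (ae_of_all _ fun θ => (norm_expMode k θ).le)

theorem integral_exp_int_mul (n : ℤ) :
    ∫ x in Icc (-Real.pi) Real.pi, Complex.exp (-Complex.I * ((n : ℝ) * x : ℝ)) =
      if n = 0 then (2 * Real.pi : ℂ) else 0 := by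
  rw [integral_Icc_eq_integral_Ioc, ← intervalIntegral.integral_of_le (by linarith [Real.pi_pos])]
  split_ifs with h
  · subst h
    simp
    ring
  · have hn : (-Complex.I * n : ℂ) ≠ 0 := by
      simp [h, Complex.I_ne_zero]
    have : ∀ x : ℝ, Complex.exp (-Complex.I * ((n : ℝ) * x : ℝ)) =
        Complex.exp ((-Complex.I * n) * x) := fun x => by push_cast; ring_nf
    simp only [this]
    rw [integral_exp_mul_complex hn, div_eq_zero_iff]
    left
    rw [sub_eq_zero, Complex.exp_eq_exp_iff_exists_int]
    exact ⟨-n, by push_cast; ring⟩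

theorem cube_eq_pi (d : ℕ) : cube d = Set.pi univ fun _ => Icc (-Real.pi) Real.pi := by
  rw [cube, ← Set.pi_univ_Icc]

theorem integral_expMode {d : ℕ} (k : Fin d → ℤ) :
    ∫ θ, expMode k θ ∂(cubeMeasure d) = if k = 0 then ((2 * Real.pi) ^ d : ℂ) else 0 := by
  have h1 : ∀ θ : Fin d → ℝ, expMode k θ =
      ∏ j, Complex.exp (-Complex.I * ((k j : ℝ) * θ j : ℝ)) := fun θ => by
    rw [expMode, ← Complex.exp_sum, ← Finset.mul_sum]
    push_cast
    rfl
  simp only [h1]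
  rw [cubeMeasure, cube_eq_pi, volume_pi, Measure.restrict_pi_pi,
    integral_fintype_prod_eq_prod (𝕜 := ℂ)
      (fun j x => Complex.exp (-Complex.I * ((k j : ℝ) * x : ℝ)))]
  simp only [integral_exp_int_mul]
  split_ifs with h
  · subst h
    simp
  · obtain ⟨j, hj⟩ := Function.ne_iff.1 h
    exact Finset.prod_eq_zero (Finset.mem_univ j) (by simpa using hj)

theorem conj_expMode {d : ℕ} (k : Fin d → ℤ) (θ : Fin d → ℝ) :
    (starRingEnd ℂ) (expMode k θ) = expMode (-k) θ := by
  rw [expMode, expMode, ← Complex.exp_conj]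
  congr 1
  simp

/-- The normalisation `(2π)^{d/2}`. -/
def cubeScale (d : ℕ) : ℝ := √((2 * Real.pi) ^ d)

theorem cubeScale_pos (d : ℕ) : 0 < cubeScale d :=
  Real.sqrt_pos.2 (by have := Real.pi_pos; positivity)

theorem cubeScale_sq (d : ℕ) : cubeScale d ^ 2 = (2 * Real.pi) ^ d :=
  Real.sq_sqrt (by have := Real.pi_pos; positivity)

/-- The normalised characters in `L²` of the cube. -/
def modeLp {d : ℕ} (k : Fin d → ℤ) : Lp ℂ 2 (cubeMeasure d) :=
  ((cubeScale d)⁻¹ : ℂ) • (memLp_expMode k).toLp (expMode k)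

theorem orthonormal_modeLp (d : ℕ) : Orthonormal ℂ (modeLp (d := d)) := by
  classical
  rw [orthonormal_iff_ite]
  intro k l
  have h : inner ℂ ((memLp_expMode k).toLp (expMode k)) ((memLp_expMode l).toLp (expMode l)) =
      if k = l then ((2 * Real.pi) ^ d : ℂ) else 0 := by
    rw [L2.inner_def]
    have : (fun θ => inner ℂ ((memLp_expMode k).toLp (expMode k) θ)
        ((memLp_expMode l).toLp (expMode l) θ)) =ᵐ[cubeMeasure d] fun θ => expMode (l - k) θ := by
      filter_upwards [(memLp_expMode k).coeFn_toLp, (memLp_expMode l).coeFn_toLp] with θ h1 h2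
      rw [h1, h2, RCLike.inner_apply, conj_expMode, ← expMode_add, sub_eq_add_neg]
    rw [integral_congr_ae this, integral_expMode]
    simp only [sub_eq_zero, eq_comm]
  rw [modeLp, modeLp, inner_smul_left, inner_smul_right, h]
  split_ifs with hkl
  · have h2 : (cubeScale d : ℂ) ^ 2 = (2 * Real.pi) ^ d := by exact_mod_cast cubeScale_sq d
    have h3 : (cubeScale d : ℂ) ≠ 0 := by exact_mod_cast (cubeScale_pos d).ne'
    rw [← h2]
    simp only [map_inv₀, Complex.conj_ofReal]
    field_simp
  · simp

/-- The Fourier transform on `ℓ²(ℤᵈ)`, normalised to be an isometry. -/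
def fourierLp (d : ℕ) : Ell2 d →ₗᵢ[ℂ] Lp ℂ 2 (cubeMeasure d) :=
  (orthonormal_modeLp d).orthogonalFamily.linearIsometry

theorem hasSum_fourierLp {d : ℕ} (f : Ell2 d) :
    HasSum (fun k => f k • modeLp k) (fourierLp d f) :=
  (orthonormal_modeLp d).orthogonalFamily.hasSum_linearIsometry f

theorem isDTFT_fourierLp {d : ℕ} (f : Ell2 d) :
    IsDTFT f (fun θ => (cubeScale d : ℂ) * fourierLp d f θ) := by
  refine ⟨(Lp.memLp _).const_mul _, ?_⟩
  have h := (hasSum_fourierLp f)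
  rw [HasSum, SummationFilter.unconditional_filter, tendsto_iff_norm_sub_tendsto_zero] at h
  have h' := (h.const_mul (cubeScale d))
  rw [mul_zero] at h'
  have h'' := ENNReal.tendsto_ofReal h'
  rw [ENNReal.ofReal_zero] at h''
  refine h''.congr fun s => ?_
  rw [ENNReal.ofReal_mul (cubeScale_pos d).le, Lp.norm_def, ENNReal.ofReal_toReal (Lp.eLpNorm_ne_top _)]
  have h3 : (cubeScale d : ℂ) ≠ 0 := by exact_mod_cast (cubeScale_pos d).ne'
  have hc : ENNReal.ofReal (cubeScale d) = ‖(cubeScale d : ℂ)‖ₑ := by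
    rw [← ofReal_norm, Complex.norm_real, Real.norm_of_nonneg (cubeScale_pos d).le]
  rw [hc, ← eLpNorm_const_smul]
  refine eLpNorm_congr_ae ?_
  have hmode : ∀ k ∈ s, (f k • modeLp k : Lp ℂ 2 (cubeMeasure d)) =ᵐ[cubeMeasure d]
      fun θ => f k * ((cubeScale d : ℂ)⁻¹ * expMode k θ) := by
    intro k _
    filter_upwards [Lp.coeFn_smul (f k) (modeLp k),
      Lp.coeFn_smul ((cubeScale d : ℂ)⁻¹) ((memLp_expMode k).toLp (expMode k)),
      (memLp_expMode k).coeFn_toLp] with θ h1 h2 h4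
    rw [h1, Pi.smul_apply, modeLp, h2, Pi.smul_apply, h4]
    rfl
  have hsum : ((∑ k ∈ s, f k • modeLp k : Lp ℂ 2 (cubeMeasure d)) : (Fin d → ℝ) → ℂ)
      =ᵐ[cubeMeasure d] fun θ => ∑ k ∈ s, f k * ((cubeScale d : ℂ)⁻¹ * expMode k θ) := by
    have h5 : ∀ᵐ θ ∂(cubeMeasure d), ∀ k ∈ s, (f k • modeLp k : Lp ℂ 2 (cubeMeasure d)) θ =
        f k * ((cubeScale d : ℂ)⁻¹ * expMode k θ) :=
      (Finset.eventually_all s).2 hmode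
    filter_upwards [Lp.coeFn_finsetSum s (fun k => (f k • modeLp k : Lp ℂ 2 (cubeMeasure d))), h5]
      with θ h6 h7
    rw [h6, Finset.sum_apply]
    exact Finset.sum_congr rfl h7
  filter_upwards [Lp.coeFn_sub (∑ k ∈ s, f k • modeLp k) (fourierLp d f), hsum] with θ h8 h9
  simp only [Pi.smul_apply, smul_eq_mul]
  rw [h8, Pi.sub_apply, h9, mul_sub, Finset.mul_sum]
  congr 1
  refine Finset.sum_congr rfl fun k _ => ?_
  rw [expMode]
  field_simp

/-- Limits in `L²` are unique, so any representative supplied with the data may be replaced by a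
multiple of the isometry `fourierLp`. -/
theorem IsDTFT.ae_eq {d : ℕ} {f : Ell2 d} {F G : (Fin d → ℝ) → ℂ} (hF : IsDTFT f F)
    (hG : IsDTFT f G) : F =ᵐ[cubeMeasure d] G := by
  have h : eLpNorm (F - G) 2 (cubeMeasure d) = 0 := by
    have hlim := hF.2.add hG.2
    rw [add_zero] at hlim
    refine le_antisymm (ge_of_tendsto' hlim fun s => ?_) zero_le
    have hS : AEStronglyMeasurable (fun θ : Fin d → ℝ => ∑ k ∈ s,
        Complex.exp (-Complex.I * ((∑ j, (k j : ℝ) * θ j : ℝ) : ℂ)) * f k) (cubeMeasure d) :=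
      (Continuous.aestronglyMeasurable (by fun_prop))
    have := eLpNorm_sub_le (p := 2) (hS.sub hG.1.1) (hS.sub hF.1.1) (by norm_num)
    rw [add_comm]
    refine le_trans (le_of_eq ?_) this
    congr 1
    funext θ
    simp
  rw [eLpNorm_eq_zero_iff (hF.1.1.sub hG.1.1) (by norm_num)] at h
  filter_upwards [h] with θ hθ
  simpa [sub_eq_zero] using hθ

theorem IsDTFT.ae_eq_fourierLp {d : ℕ} {f : Ell2 d} {F : (Fin d → ℝ) → ℂ} (hF : IsDTFT f F) :
    F =ᵐ[cubeMeasure d] fun θ => (cubeScale d : ℂ) * fourierLp d f θ :=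
  hF.ae_eq (isDTFT_fourierLp f)

/-! ### Difference operators and the energy as Fourier multipliers -/

/-- Translation `f ↦ f(· + v)` on `ℓ²(ℤᵈ)`. -/
def translate {d : ℕ} (v : Fin d → ℤ) (f : Ell2 d) : Ell2 d :=
  ⟨fun k => f (k + v), (memℓp_gen_iff (by norm_num)).2
    ((Equiv.addRight v).summable_iff.2 ((memℓp_gen_iff (by norm_num)).1 (lp.memℓp f)))⟩

@[simp]
theorem translate_apply {d : ℕ} (v : Fin d → ℤ) (f : Ell2 d) (k : Fin d → ℤ) :
    translate v f k = f (k + v) := rfl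

theorem IsDTFT.translate {d : ℕ} {f : Ell2 d} {F : (Fin d → ℝ) → ℂ} (hF : IsDTFT f F)
    (v : Fin d → ℤ) : IsDTFT (translate v f) (fun θ => expMode (-v) θ * F θ) := by
  refine ⟨?_, ?_⟩
  · refine hF.1.of_le_mul (c := 1)
      ((continuous_expMode _).aestronglyMeasurable.mul hF.1.1) (ae_of_all _ fun θ => ?_)
    rw [norm_mul, norm_expMode]
  -- Shifting the index set is cofinal among finite sets, so the partial sums of the translated
  -- series are unimodular multiples of partial sums of the original one.
  · have hmap : Tendsto (fun s : Finset (Fin d → ℤ) => s.map (Equiv.addRight v).toEmbedding)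
        atTop atTop := by
      refine tendsto_atTop.2 fun t => ?_
      filter_upwards [eventually_ge_atTop (t.map (Equiv.addRight v).symm.toEmbedding)] with s hs
      intro x hx
      rw [Finset.mem_map_equiv]
      exact hs (by rw [Finset.mem_map_equiv]; simpa using hx)
    refine (hF.2.comp hmap).congr fun s => ?_
    simp only [Function.comp_apply]
    refine eLpNorm_congr_norm_ae (ae_of_all _ fun θ => ?_)
    rw [← one_mul ‖_ - F θ‖, ← norm_expMode (-v) θ, ← norm_mul, mul_sub, Finset.mul_sum,
      Finset.sum_map]
    congr 2
    refine Finset.sum_congr rfl fun k _ => ?_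
    change expMode (-v) θ * (expMode (k + v) θ * f (k + v)) = expMode k θ * f (k + v)
    rw [← mul_assoc, ← expMode_add]
    congr 2
    abel

theorem fourierLp_translate {d : ℕ} (v : Fin d → ℤ) (f : Ell2 d) :
    fourierLp d (translate v f) =ᵐ[cubeMeasure d] fun θ => expMode (-v) θ * fourierLp d f θ := by
  filter_upwards [((isDTFT_fourierLp f).translate v).ae_eq_fourierLp] with θ h
  have h3 : (cubeScale d : ℂ) ≠ 0 := by exact_mod_cast (cubeScale_pos d).ne'
  refine mul_left_cancel₀ h3 ?_
  rw [← h]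
  ring

theorem expMode_neg_single {d : ℕ} (j : Fin d) (θ : Fin d → ℝ) :
    expMode (-Pi.single j 1) θ = Complex.exp (Complex.I * θ j) := by
  rw [expMode]
  congr 1
  simp [Pi.single_apply]

theorem expMode_single {d : ℕ} (j : Fin d) (θ : Fin d → ℝ) :
    expMode (Pi.single j 1) θ = Complex.exp (-Complex.I * θ j) := by
  rw [expMode]
  congr 1
  simp [Pi.single_apply]

@[fun_prop]
theorem continuous_xi {d : ℕ} (j : Fin d) : Continuous (xi j) := by
  unfold xi
  fun_prop

theorem exp_add_exp_sub_two {d : ℕ} (j : Fin d) (θ : Fin d → ℝ) :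
    expMode (-Pi.single j 1) θ + expMode (Pi.single j 1) θ - 2 = -((xi j θ ^ 2 : ℝ) : ℂ) := by
  have h : xi j θ ^ 2 = 2 - 2 * Real.cos (θ j) := by
    have h1 := Real.cos_sq' (θ j / 2)
    have h2 := Real.cos_two_mul (θ j / 2)
    rw [show 2 * (θ j / 2) = θ j by ring] at h2
    rw [xi, h2]
    nlinarith
  rw [expMode_neg_single, expMode_single, h]
  push_cast
  rw [Complex.two_cos]
  ring_nf

theorem norm_expMode_sub_one_sq {d : ℕ} (j : Fin d) (θ : Fin d → ℝ) :
    ‖expMode (-Pi.single j 1) θ - 1‖ ^ 2 = xi j θ ^ 2 := by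
  have h := exp_add_exp_sub_two j θ
  have h1 : ((‖expMode (-Pi.single j 1) θ - 1‖ ^ 2 : ℝ) : ℂ) = ((xi j θ ^ 2 : ℝ) : ℂ) := by
    rw [← Complex.normSq_eq_norm_sq, ← Complex.mul_conj, map_sub, map_one, conj_expMode, neg_neg]
    have h2 : expMode (-Pi.single j 1) θ * expMode (Pi.single j 1) θ = 1 := by
      rw [← expMode_add, neg_add_cancel]; simp [expMode]
    linear_combination h2 - h
  exact_mod_cast h1

/-- The discrete Laplacian `∑_j D_j⁺ D_j⁻` on `ℓ²(ℤᵈ)`. -/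
def laplacian {d : ℕ} (f : Ell2 d) : Ell2 d :=
  ∑ j, (translate (Pi.single j 1) f + translate (-Pi.single j 1) f - (2 : ℂ) • f)

theorem laplacian_apply {d : ℕ} (f : Ell2 d) (k : Fin d → ℤ) :
    laplacian f k = ∑ j, Dplus j (Dminus j f) k := by
  rw [laplacian, lp.coeFn_sum, Finset.sum_apply]
  refine Finset.sum_congr rfl fun j _ => ?_
  simp only [lp.coeFn_sub, lp.coeFn_add, lp.coeFn_smul, Pi.sub_apply, Pi.add_apply, Pi.smul_apply,
    translate_apply, Dplus, Dminus, smul_eq_mul, add_sub_cancel_right, ← sub_eq_add_neg]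
  ring

theorem xiNorm_sq {d : ℕ} (θ : Fin d → ℝ) : xiNorm θ ^ 2 = ∑ j, xi j θ ^ 2 :=
  Real.sq_sqrt (Finset.sum_nonneg fun _ _ => sq_nonneg _)

theorem fourierLp_laplacian {d : ℕ} (f : Ell2 d) :
    fourierLp d (laplacian f) =ᵐ[cubeMeasure d]
      fun θ => -((xiNorm θ ^ 2 : ℝ) : ℂ) * fourierLp d f θ := by
  have h1 : ∀ᵐ θ ∂(cubeMeasure d), ∀ j ∈ (Finset.univ : Finset (Fin d)),
      fourierLp d (translate (Pi.single j 1) f + translate (-Pi.single j 1) f - (2 : ℂ) • f) θ =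
        -((xi j θ ^ 2 : ℝ) : ℂ) * fourierLp d f θ := by
    refine (Finset.eventually_all _).2 fun j _ => ?_
    rw [map_sub, map_add, map_smul]
    filter_upwards [fourierLp_translate (Pi.single j 1) f, fourierLp_translate (-Pi.single j 1) f,
      Lp.coeFn_sub (fourierLp d (translate (Pi.single j 1) f) +
        fourierLp d (translate (-Pi.single j 1) f)) ((2 : ℂ) • fourierLp d f),
      Lp.coeFn_add (fourierLp d (translate (Pi.single j 1) f))
        (fourierLp d (translate (-Pi.single j 1) f)),
      Lp.coeFn_smul (2 : ℂ) (fourierLp d f)] with θ h2 h3 h4 h5 h6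
    rw [h4, Pi.sub_apply, h5, Pi.add_apply, h6, Pi.smul_apply, h2, h3, neg_neg,
      ← exp_add_exp_sub_two j θ, smul_eq_mul]
    ring
  rw [laplacian, map_sum]
  filter_upwards [h1, Lp.coeFn_finsetSum Finset.univ fun j => fourierLp d
    (translate (Pi.single j 1) f + translate (-Pi.single j 1) f - (2 : ℂ) • f)] with θ h2 h3
  rw [h3, Finset.sum_apply, Finset.sum_congr rfl h2, xiNorm_sq]
  push_cast
  rw [← Finset.sum_mul, Finset.sum_neg_distrib]

theorem lintegral_enorm_sq_Lp {α : Type*} [MeasurableSpace α] {μ : Measure α} (F : Lp ℂ 2 μ) :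
    ∫⁻ x, ‖F x‖ₑ ^ 2 ∂μ = ENNReal.ofReal (‖F‖ ^ 2) := by
  rw [Lp.norm_def, ENNReal.ofReal_pow ENNReal.toReal_nonneg,
    ENNReal.ofReal_toReal (Lp.eLpNorm_ne_top F),
    eLpNorm_eq_lintegral_rpow_enorm_toReal (by norm_num) (by norm_num), ← ENNReal.rpow_natCast,
    ← ENNReal.rpow_mul]
  simp

theorem tsum_enorm_sq {d : ℕ} (f : Ell2 d) :
    ∑' k, ‖f k‖ₑ ^ 2 = ∫⁻ θ, ‖fourierLp d f θ‖ₑ ^ 2 ∂(cubeMeasure d) := by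
  rw [lintegral_enorm_sq_Lp, LinearIsometry.norm_map]
  have h := lp.hasSum_norm (p := 2) (by norm_num) f
  have h2 : HasSum (fun k => ‖f k‖ ^ 2) (‖f‖ ^ 2) := by
    simpa using h
  rw [← h2.tsum_eq, ENNReal.ofReal_tsum_of_nonneg (fun k => by positivity) h2.summable]
  refine tsum_congr fun k => ?_
  rw [ENNReal.ofReal_pow (norm_nonneg _), ofReal_norm]

/-- The energy in frequency space. -/
theorem energy_eq_lintegral {d : ℕ} (a : ℝ → ℝ) (u u' : ℝ → Ell2 d) (t : ℝ) :
    energy a u u' t = ∫⁻ θ, (‖fourierLp d (u' t) θ‖ₑ ^ 2 +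
      ENNReal.ofReal (a t ^ 2 * xiNorm θ ^ 2) * ‖fourierLp d (u t) θ‖ₑ ^ 2) ∂(cubeMeasure d) := by
  have hm : ∀ f : Ell2 d, AEMeasurable (fun θ => ‖fourierLp d f θ‖ₑ ^ 2) (cubeMeasure d) :=
    fun f => (Lp.aestronglyMeasurable _).enorm.pow_const 2
  have hD : ∀ j : Fin d, ∑' k, ‖Dplus j (u t) k‖ₑ ^ 2 = ∫⁻ θ,
      ENNReal.ofReal (xi j θ ^ 2) * ‖fourierLp d (u t) θ‖ₑ ^ 2 ∂(cubeMeasure d) := by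
    intro j
    have h1 : ∀ k, Dplus j (u t) k = (translate (Pi.single j 1) (u t) - u t) k := fun k => rfl
    simp only [h1]
    rw [tsum_enorm_sq, map_sub]
    refine lintegral_congr_ae ?_
    filter_upwards [Lp.coeFn_sub (fourierLp d (translate (Pi.single j 1) (u t)))
      (fourierLp d (u t)), fourierLp_translate (Pi.single j 1) (u t)] with θ h2 h3
    rw [h2, Pi.sub_apply, h3, ← norm_expMode_sub_one_sq, ENNReal.ofReal_pow (norm_nonneg _),
      ofReal_norm, ← mul_pow, ← enorm_mul, sub_one_mul]
  rw [energy, tsum_enorm_sq, lintegral_add_left' (hm _)]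
  congr 1
  simp only [hD]
  rw [← lintegral_finsetSum', ← lintegral_const_mul']
  · refine lintegral_congr fun θ => ?_
    rw [← Finset.sum_mul, ← mul_assoc, ENNReal.ofReal_mul (sq_nonneg _), xiNorm_sq,
      ENNReal.ofReal_sum_of_nonneg fun _ _ => sq_nonneg _]
  · exact ENNReal.ofReal_ne_top
  · intro j _
    exact ((continuous_xi j).measurable.pow_const 2).ennreal_ofReal.aemeasurable.mul (hm _)

/-! ### The energy estimate with an exponential weight -/

theorem xiNorm_nonneg {d : ℕ} (θ : Fin d → ℝ) : 0 ≤ xiNorm θ := Real.sqrt_nonneg _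

@[fun_prop]
theorem continuous_xiNorm {d : ℕ} : Continuous (xiNorm (d := d)) := by
  unfold xiNorm
  fun_prop

theorem xiNorm_le {d : ℕ} (θ : Fin d → ℝ) : xiNorm θ ≤ 2 * √d := by
  refine Real.sqrt_le_iff.2 ⟨by positivity, ?_⟩
  rw [mul_pow, Real.sq_sqrt (Nat.cast_nonneg d)]
  calc ∑ j, xi j θ ^ 2 ≤ ∑ _j : Fin d, (2 : ℝ) ^ 2 := by
        refine Finset.sum_le_sum fun j _ => ?_
        rw [xi, mul_pow]
        nlinarith [Real.sin_sq_le_one (θ j / 2)]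
    _ = 2 ^ 2 * d := by simp; ring

theorem abs_xi_le_xiNorm {d : ℕ} (j : Fin d) (θ : Fin d → ℝ) : |xi j θ| ≤ xiNorm θ := by
  rw [← Real.sqrt_sq_eq_abs]
  exact Real.sqrt_le_sqrt
    (Finset.single_le_sum (f := fun j => xi j θ ^ 2) (fun _ _ => sq_nonneg _) (Finset.mem_univ j))

/-- Jordan's inequality for the sine. It converts decay in `‖θ‖`, which the Gevrey condition
provides, into decay in `|ξ|`. -/
theorem norm_le_xiNorm {d : ℕ} {θ : Fin d → ℝ} (hθ : θ ∈ cube d) :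
    ‖θ‖ ≤ Real.pi / 2 * xiNorm θ := by
  have hπ := Real.pi_pos
  refine (pi_norm_le_iff_of_nonneg (mul_nonneg (by positivity) (xiNorm_nonneg θ))).2 fun j => ?_
  have h1 := hθ.1 j
  have h2 := hθ.2 j
  simp only at h1 h2
  have h3 : |θ j / 2| ≤ Real.pi / 2 := by rw [abs_le]; constructor <;> linarith
  have h4 := Real.mul_abs_le_abs_sin h3
  have h5 : ‖θ j‖ ≤ Real.pi / 2 * |xi j θ| := by
    rw [xi, abs_mul, abs_two, Real.norm_eq_abs]
    rw [abs_div, abs_two, div_mul_div_comm, mul_comm Real.pi, div_le_iff₀ (by positivity)] at h4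
    linarith
  exact h5.trans (mul_le_mul_of_nonneg_left (abs_xi_le_xiNorm j θ) (by positivity))

theorem ae_xiNorm_pos {d : ℕ} (hd : 1 ≤ d) : ∀ᵐ θ ∂(cubeMeasure d), 0 < xiNorm θ := by
  have : Nonempty (Fin d) := ⟨⟨0, hd⟩⟩
  have h0 : ∀ᵐ θ : Fin d → ℝ, θ ≠ 0 := by
    rw [ae_iff]
    simp
  filter_upwards [ae_restrict_of_ae h0, ae_restrict_mem measurableSet_Icc] with θ h1 h2
  refine (xiNorm_nonneg θ).lt_of_ne fun h => h1 ?_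
  have := norm_le_xiNorm h2
  rw [← h, mul_zero] at this
  exact norm_le_zero_iff.1 this

/-! ### Localisation to thin shells in frequency -/

/-- The Fourier transform localised to `B`. -/
def localFourier {d : ℕ} (B : Set (Fin d → ℝ)) :
    Ell2 d →L[ℂ] Lp ℂ 2 ((cubeMeasure d).restrict B) :=
  (LpToLpRestrictCLM (Fin d → ℝ) ℂ ℂ (cubeMeasure d) 2 B).comp
    (fourierLp d).toContinuousLinearMap

theorem localFourier_coeFn {d : ℕ} (B : Set (Fin d → ℝ)) (f : Ell2 d) :
    localFourier B f =ᵐ[(cubeMeasure d).restrict B] fourierLp d f :=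
  LpToLpRestrictCLM_coeFn ℂ B (fourierLp d f)

theorem ofReal_norm_localFourier_sq {d : ℕ} (B : Set (Fin d → ℝ)) (f : Ell2 d) :
    ENNReal.ofReal (‖localFourier B f‖ ^ 2) =
      ∫⁻ θ in B, ‖fourierLp d f θ‖ₑ ^ 2 ∂(cubeMeasure d) := by
  rw [← lintegral_enorm_sq_Lp]
  refine lintegral_congr_ae ?_
  filter_upwards [localFourier_coeFn B f] with θ h
  rw [h]

/-- On `B` the multiplier `|ξ|²` differs from `r²` by at most `2 δ r²`, so the localised solution is
an oscillator with the single frequency `r`, up to an error. -/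
theorem IsSolution.isApproxOscillator {d : ℕ} {a : ℝ → ℝ} {a₁ : ℝ} (ha₁ : 0 < a₁)
    (hab : ∀ t : ℝ, 0 ≤ t → 0 ≤ a t ∧ a t ≤ a₁) {u₀ u₁ : Ell2 d} {u u' : ℝ → Ell2 d}
    (hu : IsSolution a u₀ u₁ u u') {B : Set (Fin d → ℝ)} (hBm : MeasurableSet B) {r δ T : ℝ}
    (hδ : 0 ≤ δ) (hB : ∀ θ ∈ B, r ≤ (1 + δ) * xiNorm θ ∧ xiNorm θ ≤ r) :
    ∃ v' : ℝ → Lp ℂ 2 ((cubeMeasure d).restrict B),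
      IsApproxOscillator a r (a₁ ^ 2 * (2 * δ)) T (fun t => localFourier B (u t))
        (fun t => localFourier B (u' t)) v' := by
  choose! w hw hwe using hu.deriv_snd
  have hcomp : ∀ (f : ℝ → Ell2 d) (f' : Ell2 d) (t : ℝ), HasDerivWithinAt f f' (Ici 0) t →
      HasDerivWithinAt (fun t => localFourier B (f t)) (localFourier B f') (Ici 0) t :=
    fun f f' t hf =>
      ((localFourier B).restrictScalars ℝ).hasFDerivAt.comp_hasDerivWithinAt t hf
  refine ⟨fun t => localFourier B (w t), fun t ht => hcomp _ _ t (hu.deriv_fst t ht),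
    fun t ht => hcomp _ _ t (hw t ht), fun t ht => ?_⟩
  have hwt : w t = ((a t : ℂ) ^ 2) • laplacian (u t) := by
    ext k
    rw [lp.coeFn_smul, Pi.smul_apply, laplacian_apply, smul_eq_mul]
    exact sub_eq_zero.1 (hwe t ht.1 k)
  refine Lp.norm_le_mul_norm_of_ae_le_mul ?_
  rw [hwt, map_smul]
  filter_upwards [Lp.coeFn_add ((a t : ℂ) ^ 2 • localFourier B (laplacian (u t)))
      ((a t ^ 2 * r ^ 2) • localFourier B (u t)),
    Lp.coeFn_smul ((a t : ℂ) ^ 2) (localFourier B (laplacian (u t))),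
    Lp.coeFn_smul (a t ^ 2 * r ^ 2) (localFourier B (u t)),
    localFourier_coeFn B (laplacian (u t)), localFourier_coeFn B (u t),
    ae_restrict_of_ae (s := B) (fourierLp_laplacian (u t)), ae_restrict_mem hBm]
    with θ h1 h2 h3 h4 h5 h6 h7
  rw [h1, Pi.add_apply, h2, h3, Pi.smul_apply, Pi.smul_apply, h4, h5, h6]
  obtain ⟨hr1, hr2⟩ := hB θ h7
  obtain ⟨ha0, ha1⟩ := hab t ht.1
  have hx := xiNorm_nonneg θ
  have e : (a t : ℂ) ^ 2 • (-((xiNorm θ ^ 2 : ℝ) : ℂ) * fourierLp d (u t) θ) +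
      (a t ^ 2 * r ^ 2) • fourierLp d (u t) θ =
      ((a t ^ 2 * (r ^ 2 - xiNorm θ ^ 2) : ℝ) : ℂ) * fourierLp d (u t) θ := by
    rw [Complex.real_smul]
    push_cast
    rw [smul_eq_mul]
    ring
  have h0 : 0 ≤ r ^ 2 - xiNorm θ ^ 2 := by nlinarith
  rw [e, norm_mul, Complex.norm_real, Real.norm_of_nonneg (by positivity)]
  refine mul_le_mul_of_nonneg_right ?_ (norm_nonneg _)
  have h8 : r ^ 2 - xiNorm θ ^ 2 ≤ 2 * δ * r ^ 2 := by
    have h9 : r - xiNorm θ ≤ δ * r := by nlinarith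
    nlinarith
  calc a t ^ 2 * (r ^ 2 - xiNorm θ ^ 2) ≤ a₁ ^ 2 * (2 * δ * r ^ 2) := by gcongr
    _ = _ := by ring

/-- The reference frequency `r` bounds `|ξ|` from above on `B`, so `r^{-σ} ≤ |ξ|^{-σ}` and the
exponential weight can be moved inside the integral with no loss. In the energy, `r² ≤ 4 |ξ|²`
because `δ ≤ 1`. Since `hest` quantifies over all spaces, one constant serves every shell. -/
theorem lintegral_shell_le {d : ℕ} {a : ℝ → ℝ} {a₁ C c σ : ℝ} (ha₁ : 0 < a₁)
    (hab : ∀ t : ℝ, 0 ≤ t → 0 ≤ a t ∧ a t ≤ a₁) (hC : 0 < C) (hc : 0 < c) (hσ : 0 ≤ σ)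
    (hest : ∀ (H : Type) [NormedAddCommGroup H] [InnerProductSpace ℝ H]
      (r δ T : ℝ) (w v v' : ℝ → H), 0 < r → r ≤ 2 * √d → 0 ≤ T → 0 ≤ δ →
      δ * (1 + T) ≤ a₁ ^ 2 * 2 → IsApproxOscillator a r δ T w v v' →
      ‖v T‖ ^ 2 + r ^ 2 * ‖w T‖ ^ 2 ≤
        C * Real.exp (c * r ^ (-σ)) * (‖v 0‖ ^ 2 + r ^ 2 * ‖w 0‖ ^ 2))
    {u₀ u₁ : Ell2 d} {u u' : ℝ → Ell2 d}
    (hu : IsSolution a u₀ u₁ u u') {B : Set (Fin d → ℝ)} (hBm : MeasurableSet B) {r δ T : ℝ}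
    (hT : 0 ≤ T) (hδ : 0 ≤ δ) (hδT : δ * (1 + T) = 1) (hr : 0 < r) (hrR : r ≤ 2 * √d)
    (hB : ∀ θ ∈ B, r ≤ (1 + δ) * xiNorm θ ∧ xiNorm θ ≤ r) :
    ∫⁻ θ in B, (‖fourierLp d (u' T) θ‖ₑ ^ 2 +
      ENNReal.ofReal (a T ^ 2 * xiNorm θ ^ 2) * ‖fourierLp d (u T) θ‖ₑ ^ 2) ∂(cubeMeasure d) ≤
    ENNReal.ofReal (4 * (1 + a₁ ^ 2) * C) * ∫⁻ θ in B, ENNReal.ofReal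
      (Real.exp (c * xiNorm θ ^ (-σ)) * (‖fourierLp d u₁ θ‖ ^ 2 +
        xiNorm θ ^ 2 * ‖fourierLp d u₀ θ‖ ^ 2)) ∂(cubeMeasure d) := by
  obtain ⟨v', hosc⟩ := hu.isApproxOscillator ha₁ hab hBm (T := T) hδ hB
  have h := hest _ r _ T _ _ _ hr hrR hT (by positivity)
    (by rw [mul_assoc, mul_assoc, hδT, mul_one]) hosc
  simp only [hu.init_fst, hu.init_snd] at h
  set T₁ := localFourier B (u' T)
  set T₀ := localFourier B (u T)
  set I₁ := localFourier B u₁ with hI₁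
  set I₀ := localFourier B u₀ with hI₀
  have hpt : ∀ θ ∈ B, ENNReal.ofReal (Real.exp (c * r ^ (-σ)) * (‖fourierLp d u₁ θ‖ ^ 2 +
      r ^ 2 * ‖fourierLp d u₀ θ‖ ^ 2)) ≤ ENNReal.ofReal 4 * ENNReal.ofReal
      (Real.exp (c * xiNorm θ ^ (-σ)) * (‖fourierLp d u₁ θ‖ ^ 2 +
        xiNorm θ ^ 2 * ‖fourierLp d u₀ θ‖ ^ 2)) := by
    intro θ hθ
    obtain ⟨h1, h2⟩ := hB θ hθ
    have hδ1 : δ ≤ 1 := by nlinarith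
    have hx : 0 < xiNorm θ := by
      by_contra hx
      have : xiNorm θ = 0 := le_antisymm (not_lt.1 hx) (xiNorm_nonneg θ)
      rw [this] at h1
      linarith
    have h3 : r ≤ 2 * xiNorm θ := by nlinarith
    have h4 : r ^ 2 ≤ 4 * xiNorm θ ^ 2 := by nlinarith
    have h5 : r ^ (-σ) ≤ xiNorm θ ^ (-σ) := Real.rpow_le_rpow_of_nonpos hx h2 (by linarith)
    rw [← ENNReal.ofReal_mul (by norm_num)]
    refine ENNReal.ofReal_le_ofReal ?_
    rw [mul_left_comm]
    refine mul_le_mul (Real.exp_le_exp.2 (mul_le_mul_of_nonneg_left h5 hc.le)) ?_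
      (by positivity) (by positivity)
    nlinarith [sq_nonneg ‖fourierLp d u₁ θ‖, mul_le_mul_of_nonneg_right h4
      (sq_nonneg ‖fourierLp d u₀ θ‖)]
  have hm : ∀ f : Ell2 d, AEMeasurable (fun θ => ‖fourierLp d f θ‖ₑ ^ 2)
      ((cubeMeasure d).restrict B) :=
    fun f => ((Lp.aestronglyMeasurable (fourierLp d f)).enorm.pow_const 2).restrict
  have hsplit : ∀ (f g : Ell2 d) (x : ℝ), 0 ≤ x →
      ENNReal.ofReal (‖localFourier B f‖ ^ 2 + x * ‖localFourier B g‖ ^ 2) =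
      ∫⁻ θ in B, (‖fourierLp d f θ‖ₑ ^ 2 + ENNReal.ofReal x * ‖fourierLp d g θ‖ₑ ^ 2)
        ∂(cubeMeasure d) := by
    intro f g x hx
    rw [lintegral_add_left' (hm f), lintegral_const_mul' _ _ ENNReal.ofReal_ne_top,
      ← ofReal_norm_localFourier_sq, ← ofReal_norm_localFourier_sq, ← ENNReal.ofReal_mul hx,
      ← ENNReal.ofReal_add (by positivity) (by positivity)]
  calc ∫⁻ θ in B, (‖fourierLp d (u' T) θ‖ₑ ^ 2 +
      ENNReal.ofReal (a T ^ 2 * xiNorm θ ^ 2) * ‖fourierLp d (u T) θ‖ₑ ^ 2) ∂(cubeMeasure d)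
      ≤ ∫⁻ θ in B, (‖fourierLp d (u' T) θ‖ₑ ^ 2 +
        ENNReal.ofReal (a₁ ^ 2 * r ^ 2) * ‖fourierLp d (u T) θ‖ₑ ^ 2) ∂(cubeMeasure d) := by
        refine setLIntegral_mono' hBm fun θ hθ => ?_
        gcongr
        · exact (hab T hT).1
        · exact (hab T hT).2
        · exact xiNorm_nonneg θ
        · exact (hB θ hθ).2
    _ = ENNReal.ofReal (‖T₁‖ ^ 2 + a₁ ^ 2 * r ^ 2 * ‖T₀‖ ^ 2) :=
        (hsplit _ _ _ (by positivity)).symm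
    _ ≤ ENNReal.ofReal ((1 + a₁ ^ 2) * C *
          (Real.exp (c * r ^ (-σ)) * (‖I₁‖ ^ 2 + r ^ 2 * ‖I₀‖ ^ 2))) := by
        refine ENNReal.ofReal_le_ofReal ?_
        have h0 : 0 ≤ ‖T₁‖ ^ 2 := by positivity
        have h1 : 0 ≤ r ^ 2 * ‖T₀‖ ^ 2 := by positivity
        have h2 : 0 ≤ a₁ ^ 2 := by positivity
        calc _ ≤ (1 + a₁ ^ 2) * (‖T₁‖ ^ 2 + r ^ 2 * ‖T₀‖ ^ 2) := by nlinarith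
          _ ≤ (1 + a₁ ^ 2) * (C * Real.exp (c * r ^ (-σ)) * (‖I₁‖ ^ 2 + r ^ 2 * ‖I₀‖ ^ 2)) := by
            gcongr
          _ = _ := by ring
    _ = ENNReal.ofReal ((1 + a₁ ^ 2) * C) * ∫⁻ θ in B, ENNReal.ofReal (Real.exp (c * r ^ (-σ)) *
          (‖fourierLp d u₁ θ‖ ^ 2 + r ^ 2 * ‖fourierLp d u₀ θ‖ ^ 2)) ∂(cubeMeasure d) := by
        rw [ENNReal.ofReal_mul (by positivity), ENNReal.ofReal_mul (Real.exp_pos _).le,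
          hsplit _ _ _ (by positivity), ← lintegral_const_mul' _ _ ENNReal.ofReal_ne_top]
        congr 1
        refine lintegral_congr fun θ => ?_
        rw [ENNReal.ofReal_mul (Real.exp_pos _).le, ENNReal.ofReal_add (by positivity)
          (by positivity), ENNReal.ofReal_mul (by positivity), ENNReal.ofReal_pow (norm_nonneg _),
          ENNReal.ofReal_pow (norm_nonneg _), ofReal_norm, ofReal_norm]
    _ ≤ ENNReal.ofReal ((1 + a₁ ^ 2) * C) * ∫⁻ θ in B, ENNReal.ofReal 4 * ENNReal.ofReal
          (Real.exp (c * xiNorm θ ^ (-σ)) * (‖fourierLp d u₁ θ‖ ^ 2 +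
          xiNorm θ ^ 2 * ‖fourierLp d u₀ θ‖ ^ 2)) ∂(cubeMeasure d) :=
        mul_le_mul_right (setLIntegral_mono' hBm hpt) _
    _ = _ := by
        rw [lintegral_const_mul' _ _ ENNReal.ofReal_ne_top, ← mul_assoc,
          ← ENNReal.ofReal_mul (by positivity)]
        congr 2
        ring

/-- A geometric decomposition of `{|ξ| > 0}` into thin shells. -/
def shell (d : ℕ) (δ : ℝ) (n : ℕ) : Set (Fin d → ℝ) :=
  {θ | 2 * √d / (1 + δ) ^ (n + 1) < xiNorm θ ∧ xiNorm θ ≤ 2 * √d / (1 + δ) ^ n}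

theorem measurableSet_shell (d : ℕ) (δ : ℝ) (n : ℕ) : MeasurableSet (shell d δ n) :=
  (measurableSet_lt measurable_const continuous_xiNorm.measurable).inter
    (measurableSet_le continuous_xiNorm.measurable measurable_const)

theorem pairwise_disjoint_shell (d : ℕ) {δ : ℝ} (hδ : 0 < δ) :
    Pairwise (Function.onFun Disjoint (shell d δ)) := by
  refine (pairwise_disjoint_on _).2 fun n k hnk => Set.disjoint_left.2 fun θ h1 h2 => ?_
  have h3 : 2 * √d / (1 + δ) ^ k ≤ 2 * √d / (1 + δ) ^ (n + 1) := by
    refine div_le_div_of_nonneg_left (by positivity) (by positivity) ?_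
    exact pow_le_pow_right₀ (by linarith) hnk
  exact absurd (h1.1.trans_le h2.2) (not_lt.2 h3)

theorem mem_iUnion_shell {d : ℕ} {δ : ℝ} (hδ : 0 < δ) {θ : Fin d → ℝ} (hθ : 0 < xiNorm θ) :
    θ ∈ ⋃ n, shell d δ n := by
  obtain ⟨n, h1, h2⟩ := exists_nat_pow_near (x := 2 * √d / xiNorm θ) (y := 1 + δ)
    (by rw [le_div_iff₀ hθ, one_mul]; exact xiNorm_le θ) (by linarith)
  refine mem_iUnion.2 ⟨n, ?_, ?_⟩
  · rw [div_lt_iff₀ (by positivity)]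
    rw [div_lt_iff₀ hθ] at h2
    linarith
  · rw [le_div_iff₀ (by positivity)]
    rw [le_div_iff₀ hθ] at h1
    linarith

theorem lintegral_eq_tsum_shell {d : ℕ} (hd : 1 ≤ d) {δ : ℝ} (hδ : 0 < δ)
    (f : (Fin d → ℝ) → ℝ≥0∞) : ∫⁻ θ, f θ ∂(cubeMeasure d) =
      ∑' n, ∫⁻ θ in shell d δ n, f θ ∂(cubeMeasure d) := by
  rw [← lintegral_iUnion (measurableSet_shell d δ) (pairwise_disjoint_shell d hδ)]
  rw [Measure.restrict_eq_self_of_ae_mem]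
  filter_upwards [ae_xiNorm_pos hd] with θ hθ using mem_iUnion_shell hδ hθ

/-- The shells depend on the time `T`, but the constants obtained on them do not, so summation gives
a bound uniform in time. Only the lower bound `a₀ ≤ a 0` enters in passing to `initialDensity`. -/
theorem energy_le_weighted {d : ℕ} (hd : 1 ≤ d) {m : ℕ} (hm : 1 ≤ m) {p q : ℝ} (hp : 0 ≤ p)
    (hpq : p < q) (hq : q < 1) {a Θ Ξ : ℝ → ℝ} (ha : BoundedSpeed a)
    (hΘ_le : ∃ K : ℝ, 0 < K ∧ ∀ t : ℝ, 0 ≤ t → Θ t ≤ K * (1 + t) ^ (1 - p))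
    (hΞ : ∀ t : ℝ, 0 ≤ t → Ξ t = (1 + t) ^ (p / m - q + 1))
    (hstab : Stabilizes a Θ) (hosc : OscillationBound a Ξ m) (hpm : 1 < p + m * (1 - q)) :
    ∃ C c : ℝ, 0 < C ∧ 0 < c ∧ ∀ (u₀ u₁ : Ell2 d) (F₀ F₁ : (Fin d → ℝ) → ℂ),
      IsDTFT u₀ F₀ → IsDTFT u₁ F₁ → ∀ u u' : ℝ → Ell2 d, IsSolution a u₀ u₁ u u' →
      ∀ t : ℝ, 0 ≤ t → energy a u u' t ≤ ENNReal.ofReal C *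
        ∫⁻ θ in cube d, ENNReal.ofReal
          (Real.exp (c * xiNorm θ ^ (-((q - p) / (1 - q)))) * initialDensity a F₀ F₁ θ) := by
  obtain ⟨K, hK, hΘK⟩ := hΘ_le
  obtain ⟨aInf, haInf, hst⟩ := hstab
  have ha' := ha
  obtain ⟨a₀, a₁, ha₀, ha₁, hab⟩ := ha'
  obtain ⟨C, c, hC, hc, hest⟩ := oscillator_estimate hm hp hpq hq ha hΞ hosc hpm haInf hK.le
    (fun t ht => (hst t ht).trans (hΘK t ht)) (2 * √d) (a₁ ^ 2 * 2)
  set σ := (q - p) / (1 - q) with hσdef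
  have hσ : 0 ≤ σ := div_nonneg (by linarith) (by linarith)
  set S := cubeScale d with hS
  have hSpos : 0 < S := cubeScale_pos d
  refine ⟨4 * (1 + a₁ ^ 2) * C * ((1 + (a₀ ^ 2)⁻¹) * (S ^ 2)⁻¹), c, by positivity, hc, ?_⟩
  intro u₀ u₁ F₀ F₁ hF₀ hF₁ u u' hu T hT
  -- The width for which the frequency error, accumulated up to time `T`, stays bounded
  -- independently of `T`.
  set δ : ℝ := (1 + T)⁻¹ with hδdef
  have hδ : 0 < δ := by positivity
  have hδT : δ * (1 + T) = 1 := inv_mul_cancel₀ (by positivity)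
  have hd0 : 0 < √(d : ℝ) := Real.sqrt_pos.2 (by exact_mod_cast hd)
  rw [energy_eq_lintegral, lintegral_eq_tsum_shell hd hδ]
  calc _ ≤ ∑' n, ENNReal.ofReal (4 * (1 + a₁ ^ 2) * C) * ∫⁻ θ in shell d δ n, ENNReal.ofReal
          (Real.exp (c * xiNorm θ ^ (-σ)) * (‖fourierLp d u₁ θ‖ ^ 2 +
            xiNorm θ ^ 2 * ‖fourierLp d u₀ θ‖ ^ 2)) ∂(cubeMeasure d) := by
        refine ENNReal.tsum_le_tsum fun n => ?_
        refine lintegral_shell_le ha₁ (fun t ht => ⟨ha₀.le.trans (hab t ht).1, (hab t ht).2⟩) hC hc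
          hσ hest hu (measurableSet_shell d δ n) hT hδ.le hδT (r := 2 * √d / (1 + δ) ^ n)
          (by positivity) (div_le_self (by positivity) (one_le_pow₀ (by linarith)))
          fun θ hθ => ⟨?_, hθ.2⟩
        have h1 := hθ.1.le
        rw [div_le_iff₀ (by positivity), pow_succ] at h1
        rw [div_le_iff₀ (by positivity)]
        linarith
    _ = ENNReal.ofReal (4 * (1 + a₁ ^ 2) * C) * ∫⁻ θ, ENNReal.ofReal
          (Real.exp (c * xiNorm θ ^ (-σ)) * (‖fourierLp d u₁ θ‖ ^ 2 +
            xiNorm θ ^ 2 * ‖fourierLp d u₀ θ‖ ^ 2)) ∂(cubeMeasure d) := by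
        rw [ENNReal.tsum_mul_left, ← lintegral_eq_tsum_shell hd hδ]
    _ ≤ ENNReal.ofReal (4 * (1 + a₁ ^ 2) * C) * ∫⁻ θ, ENNReal.ofReal
          ((1 + (a₀ ^ 2)⁻¹) * (S ^ 2)⁻¹) * ENNReal.ofReal
          (Real.exp (c * xiNorm θ ^ (-σ)) * initialDensity a F₀ F₁ θ) ∂(cubeMeasure d) := by
        refine mul_le_mul_right (lintegral_mono_ae ?_) _
        filter_upwards [hF₀.ae_eq_fourierLp, hF₁.ae_eq_fourierLp] with θ h0 h1
        rw [← ENNReal.ofReal_mul (by positivity)]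
        refine ENNReal.ofReal_le_ofReal ?_
        rw [mul_left_comm]
        refine mul_le_mul_of_nonneg_left ?_ (Real.exp_pos _).le
        rw [initialDensity, h0, h1, norm_mul, norm_mul, Complex.norm_real,
          Real.norm_of_nonneg (cubeScale_pos d).le, ← hS]
        set x := ‖fourierLp d u₁ θ‖ ^ 2
        set y := xiNorm θ ^ 2 * ‖fourierLp d u₀ θ‖ ^ 2 with hy
        have hx0 : 0 ≤ x := by positivity
        have hy0 : 0 ≤ y := by positivity
        have ha00 := (hab 0 le_rfl).1
        have e : (1 + (a₀ ^ 2)⁻¹) * (S ^ 2)⁻¹ * ((S * ‖fourierLp d u₁ θ‖) ^ 2 +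
            a 0 ^ 2 * xiNorm θ ^ 2 * (S * ‖fourierLp d u₀ θ‖) ^ 2) =
            (1 + (a₀ ^ 2)⁻¹) * (x + a 0 ^ 2 * y) := by
          rw [hy]; field_simp; ring
        rw [e]
        have h2 : 0 ≤ (a₀ ^ 2)⁻¹ := by positivity
        have h3 : 1 ≤ (a₀ ^ 2)⁻¹ * a 0 ^ 2 := by
          rw [inv_mul_eq_div, le_div_iff₀ (by positivity), one_mul]
          exact pow_le_pow_left₀ ha₀.le ha00 2
        nlinarith [mul_le_mul_of_nonneg_right h3 hy0, mul_nonneg h2 hx0,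
          mul_nonneg (sq_nonneg (a 0)) hy0]
    _ = _ := by
        rw [lintegral_const_mul' _ _ ENNReal.ofReal_ne_top, ← mul_assoc,
          ← ENNReal.ofReal_mul (by positivity)]

/-! ### Finiteness of the weighted energy and the choice of the constants -/

/-- Otherwise `Ξ^{-m}` would dominate a multiple of `1/t` on `(1, ∞)`. -/
theorem one_lt_of_integrableOn {m : ℕ} (hm : 1 ≤ m) {p q : ℝ} {Ξ : ℝ → ℝ}
    (hΞ : ∀ t : ℝ, 0 ≤ t → Ξ t = (1 + t) ^ (p / m - q + 1))
    (h : IntegrableOn (fun t => (Ξ t ^ m)⁻¹) (Ici 0)) : 1 < p + m * (1 - q) := by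
  by_contra hcon
  have hm0 : (0 : ℝ) < m := by exact_mod_cast hm
  have h1 : IntegrableOn (fun t : ℝ => 2 * (Ξ t ^ m)⁻¹) (Ioi 1) :=
    (h.mono_set fun t ht => (zero_le_one.trans (le_of_lt ht) : (0 : ℝ) ≤ t)).const_mul 2
  have h2 : IntegrableOn (fun t : ℝ => t ^ (-1 : ℝ)) (Ioi 1) := by
    refine h1.mono' (by fun_prop) ?_
    filter_upwards [ae_restrict_mem measurableSet_Ioi] with t ht
    have ht1 : (1 : ℝ) < t := ht
    have hpow : Ξ t ^ m = (1 + t) ^ (p + m * (1 - q)) := by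
      rw [hΞ t (by linarith), ← Real.rpow_natCast, ← Real.rpow_mul (by positivity)]
      congr 1
      field_simp
      ring
    rw [hpow, Real.norm_of_nonneg (by positivity), Real.rpow_neg_one]
    have h3 : (1 + t) ^ (p + m * (1 - q)) ≤ 2 * t := by
      calc (1 + t) ^ (p + m * (1 - q)) ≤ (1 + t) ^ (1 : ℝ) :=
            Real.rpow_le_rpow_of_exponent_le (by linarith) (not_lt.1 hcon)
        _ ≤ 2 * t := by rw [Real.rpow_one]; linarith
    calc t⁻¹ = 2 * (2 * t)⁻¹ := by field_simp
      _ ≤ _ := mul_le_mul_of_nonneg_left (inv_anti₀ (by positivity) h3) (by norm_num)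
  rw [integrableOn_Ioi_rpow_iff (by norm_num)] at h2
  exact lt_irrefl _ h2

theorem invFunOn_spec {q N r : ℝ} {Λ : ℝ → ℝ} (hq : q < 1)
    (hΛ : ∀ t : ℝ, 0 ≤ t → Λ t = (1 + t) ^ (1 - q)) (hr : 0 < r) (hrN : r ≤ N) :
    0 ≤ Function.invFunOn Λ (Ici 0) (N / r) ∧
      (1 + Function.invFunOn Λ (Ici 0) (N / r)) ^ (1 - q) = N / r := by
  have hNr : 1 ≤ N / r := by rwa [le_div_iff₀ hr, one_mul]
  have hq0 : 0 < 1 - q := by linarith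
  have hex : ∃ t ∈ Ici (0 : ℝ), Λ t = N / r := by
    have h1 := Real.one_le_rpow hNr (by positivity : 0 ≤ 1 / (1 - q))
    have h0 : 0 ≤ (N / r) ^ (1 / (1 - q)) - 1 := by linarith
    refine ⟨(N / r) ^ (1 / (1 - q)) - 1, h0, ?_⟩
    rw [hΛ _ h0, add_sub_cancel, ← Real.rpow_mul (by linarith), one_div_mul_cancel hq0.ne',
      Real.rpow_one]
  have hmem : Function.invFunOn Λ (Ici 0) (N / r) ∈ Ici (0 : ℝ) := Function.invFunOn_mem hex
  exact ⟨hmem, by rw [← hΛ _ hmem]; exact Function.invFunOn_eq hex⟩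

theorem mul_rpow_eq {p q N r t : ℝ} (hq : q < 1) (hr : 0 < r) (hN : 0 < N) (ht : 0 ≤ t)
    (h : (1 + t) ^ (1 - q) = N / r) :
    r * (1 + t) ^ (1 - p) = N ^ ((1 - p) / (1 - q)) * r ^ (-((q - p) / (1 - q))) := by
  have hq0 : 1 - q ≠ 0 := by linarith
  have e1 : -((q - p) / (1 - q)) = 1 + -((1 - p) / (1 - q)) := by field_simp; ring
  have e2 : (1 + t) ^ (1 - p) = (N / r) ^ ((1 - p) / (1 - q)) := by
    rw [← h, ← Real.rpow_mul (by linarith)]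
    congr 1
    field_simp
  rw [e2, e1, Real.rpow_add hr, Real.rpow_one, Real.rpow_neg hr.le, Real.div_rpow hN.le hr.le]
  ring

theorem initialDensity_nonneg {d : ℕ} (a : ℝ → ℝ) (F₀ F₁ : (Fin d → ℝ) → ℂ) (θ : Fin d → ℝ) :
    0 ≤ initialDensity a F₀ F₁ θ := by
  unfold initialDensity
  positivity

/-- The Gevrey hypothesis concerns the products `ξ_j û₀` and not `û₀` itself; the density involves
only these products. -/
theorem initialDensity_eq {d : ℕ} (a : ℝ → ℝ) (F₀ F₁ : (Fin d → ℝ) → ℂ) (θ : Fin d → ℝ) :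
    initialDensity a F₀ F₁ θ = ‖F₁ θ‖ ^ 2 + a 0 ^ 2 * ∑ j, ‖(xi j θ : ℂ) * F₀ θ‖ ^ 2 := by
  rw [initialDensity, xiNorm_sq, mul_assoc, Finset.sum_mul]
  congr 2
  refine Finset.sum_congr rfl fun j _ => ?_
  rw [norm_mul, mul_pow, Complex.norm_real, Real.norm_eq_abs, sq_abs]

theorem gevreyClass_anti {d : ℕ} {ν ρ ρ' : ℝ} (hρ' : 0 < ρ') (h : ρ' ≤ ρ) :
    gevreyClass d ν ρ ⊆ gevreyClass d ν ρ' := by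
  rintro f ⟨hf, C, hC⟩
  refine ⟨hf, C, fun α θ hθ => le_trans ?_ (hC α θ hθ)⟩
  gcongr

theorem VanishingDataIn.exists_radius {d : ℕ} (hd : 1 ≤ d) {ν : ℝ} {u₀ u₁ : Ell2 d}
    {F₀ F₁ : (Fin d → ℝ) → ℂ} (h : VanishingDataIn (gevreyClassInfty d ν) u₀ u₁ F₀ F₁) :
    ∃ ρ : ℝ, 0 < ρ ∧ VanishingDataIn (gevreyClass d ν ρ) u₀ u₁ F₀ F₁ := by
  have : Nonempty (Fin d) := ⟨⟨0, hd⟩⟩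
  have h0 := h.mem_fst
  have h1 := h.mem_snd
  simp only [gevreyClassInfty, mem_iUnion, mem_Ioi, exists_prop] at h0 h1
  choose R hR hRm using h0
  obtain ⟨R', hR', hRm'⟩ := h1
  obtain ⟨j₀, hj₀⟩ := Finite.exists_min R
  have hpos : 0 < min (R j₀) R' := lt_min (hR j₀) hR'
  exact ⟨min (R j₀) R', hpos, h.dtft_fst, h.dtft_snd,
    fun j => gevreyClass_anti hpos ((min_le_left _ _).trans (hj₀ j)) (hRm j),
    gevreyClass_anti hpos (min_le_right _ _) hRm', h.vanish_fst, h.vanish_snd⟩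

theorem VanishingDataIn.initialDensity_le {d : ℕ} (hd : 1 ≤ d) {ν ρ τ : ℝ} (hρ : 0 < ρ)
    (hτ : 0 < τ) (hντ : (ν - 1) * τ = 1) {u₀ u₁ : Ell2 d} {F₀ F₁ : (Fin d → ℝ) → ℂ}
    (h : VanishingDataIn (gevreyClass d ν ρ) u₀ u₁ F₀ F₁) (a : ℝ → ℝ) :
    ∃ C : ℝ, 0 ≤ C ∧ ∀ θ ∈ cube d, θ ≠ 0 → initialDensity a F₀ F₁ θ ≤
      C * Real.exp (-(2 * (ρ / (Real.exp 1 * d * ‖θ‖)) ^ τ)) := by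
  obtain ⟨C₁, hC₁, hb₁⟩ := norm_le_exp_of_mem_gevreyClass hd hρ hτ hντ h.mem_snd h.vanish_snd
  choose C₀ hC₀ hb₀ using fun j =>
    norm_le_exp_of_mem_gevreyClass hd hρ hτ hντ (h.mem_fst j) (h.vanish_fst j)
  refine ⟨C₁ ^ 2 + a 0 ^ 2 * ∑ j, C₀ j ^ 2, by positivity, fun θ hθ hne => ?_⟩
  rw [initialDensity_eq]
  set e := Real.exp (-((ρ / (Real.exp 1 * d * ‖θ‖)) ^ τ)) with he
  have hsq : Real.exp (-(2 * (ρ / (Real.exp 1 * d * ‖θ‖)) ^ τ)) = e ^ 2 := by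
    rw [he, ← Real.exp_nat_mul]; push_cast; ring_nf
  rw [hsq, add_mul, mul_assoc, Finset.sum_mul]
  gcongr with j
  · rw [← mul_pow]
    exact pow_le_pow_left₀ (norm_nonneg _) (hb₁ θ hθ hne) 2
  · rw [← mul_pow]
    exact pow_le_pow_left₀ (norm_nonneg _) (hb₀ j θ hθ hne) 2

theorem VanishingDataIn.lintegral_exp_lt_top {d : ℕ} (hd : 1 ≤ d) {ν ρ τ σ M C' : ℝ} (hρ : 0 < ρ)
    (hτ : 0 < τ) (hντ : (ν - 1) * τ = 1) {u₀ u₁ : Ell2 d} {F₀ F₁ : (Fin d → ℝ) → ℂ}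
    (h : VanishingDataIn (gevreyClass d ν ρ) u₀ u₁ F₀ F₁) (a : ℝ → ℝ)
    (hM : ∀ θ ∈ cube d, θ ≠ 0 →
      M * xiNorm θ ^ (-σ) ≤ 2 * (ρ / (Real.exp 1 * d * ‖θ‖)) ^ τ + C') :
    ∫⁻ θ in cube d, ENNReal.ofReal
      (Real.exp (M * xiNorm θ ^ (-σ)) * initialDensity a F₀ F₁ θ) < ⊤ := by
  obtain ⟨C, hC, hb⟩ := h.initialDensity_le hd hρ hτ hντ a
  calc ∫⁻ θ in cube d, ENNReal.ofReal
        (Real.exp (M * xiNorm θ ^ (-σ)) * initialDensity a F₀ F₁ θ)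
      ≤ ∫⁻ θ in cube d, ENNReal.ofReal (C * Real.exp C') := by
        refine lintegral_mono_ae ?_
        filter_upwards [ae_xiNorm_pos hd, ae_restrict_mem measurableSet_Icc] with θ h1 hθ
        have hne : θ ≠ 0 := by
          rintro rfl
          simp [xiNorm, xi] at h1
        refine ENNReal.ofReal_le_ofReal ?_
        calc _ ≤ Real.exp (2 * (ρ / (Real.exp 1 * d * ‖θ‖)) ^ τ + C') *
              (C * Real.exp (-(2 * (ρ / (Real.exp 1 * d * ‖θ‖)) ^ τ))) := by
              refine mul_le_mul (Real.exp_le_exp.2 (hM θ hθ hne)) (hb θ hθ hne)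
                (initialDensity_nonneg _ _ _ _) (Real.exp_pos _).le
          _ = C * Real.exp C' := by
              rw [mul_left_comm, ← Real.exp_add]
              ring_nf
    _ < ⊤ := by
        rw [lintegral_const]
        exact ENNReal.mul_lt_top ENNReal.ofReal_lt_top (measure_lt_top _ _)

theorem xiNorm_rpow_neg_le {d : ℕ} {σ : ℝ} (hσ : 0 ≤ σ) {θ : Fin d → ℝ} (hθ : θ ∈ cube d)
    (hne : θ ≠ 0) : xiNorm θ ^ (-σ) ≤ (Real.pi / 2 / ‖θ‖) ^ σ := by
  have h0 : 0 < ‖θ‖ := norm_pos_iff.2 hne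
  have h1 := norm_le_xiNorm hθ
  have hπ := Real.pi_pos
  have hx : 0 < xiNorm θ := by
    by_contra hx
    have : xiNorm θ = 0 := le_antisymm (not_lt.1 hx) (xiNorm_nonneg θ)
    rw [this] at h1
    linarith
  rw [Real.rpow_neg hx.le, ← Real.inv_rpow hx.le]
  refine Real.rpow_le_rpow (by positivity) ?_ hσ
  rw [inv_le_comm₀ hx (by positivity), inv_div]
  rw [div_le_iff₀ (by positivity)]
  linarith

/-- The radius for which a Gevrey function of critical order beats the weight
`exp (M |ξ|^{-σ})`. -/
theorem critical_weight_le {d : ℕ} (hd : 1 ≤ d) {σ M : ℝ} (hσ : 0 < σ) (hM : 0 < M)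
    {θ : Fin d → ℝ} (hθ : θ ∈ cube d) (hne : θ ≠ 0) :
    M * xiNorm θ ^ (-σ) ≤
      2 * (Real.exp 1 * d * (Real.pi / 2) * M ^ (1 / σ) / (Real.exp 1 * d * ‖θ‖)) ^ σ + 0 := by
  have h0 : 0 < ‖θ‖ := norm_pos_iff.2 hne
  have hd0 : (0 : ℝ) < d := by exact_mod_cast hd
  have hπ := Real.pi_pos
  -- The radius is chosen to cancel `e d` and to produce exactly `M` after raising to the power `σ`;
  -- `π / 2` comes from `norm_le_xiNorm`.
  have e : Real.exp 1 * d * (Real.pi / 2) * M ^ (1 / σ) / (Real.exp 1 * d * ‖θ‖) =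
      M ^ (1 / σ) * (Real.pi / 2 / ‖θ‖) := by
    field_simp
  rw [e, Real.mul_rpow (by positivity) (by positivity), ← Real.rpow_mul hM.le,
    one_div_mul_cancel hσ.ne', Real.rpow_one, add_zero]
  have h1 := mul_le_mul_of_nonneg_left (xiNorm_rpow_neg_le hσ.le hθ hne) hM.le
  have h2 : 0 ≤ M * (Real.pi / 2 / ‖θ‖) ^ σ := by positivity
  linarith

/-- The larger power `τ > σ` wins as `θ → 0`, whatever `M` and `ρ` are; away from the origin both
sides are bounded and `C'` absorbs the difference. -/
theorem subcritical_weight_le {d : ℕ} (hd : 1 ≤ d) {σ τ M ρ : ℝ} (hσ : 0 < σ) (hστ : σ < τ)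
    (hM : 0 < M) (hρ : 0 < ρ) : ∃ C' : ℝ, ∀ θ ∈ cube d, θ ≠ 0 →
      M * xiNorm θ ^ (-σ) ≤ 2 * (ρ / (Real.exp 1 * d * ‖θ‖)) ^ τ + C' := by
  have hd0 : (0 : ℝ) < d := by exact_mod_cast hd
  have hπ := Real.pi_pos
  set b : ℝ := Real.pi / 2 * (Real.exp 1 * d) / ρ with hb
  have hb0 : 0 < b := by positivity
  -- The point where `M b^σ z^σ` and `z^τ` coincide.
  set z₀ : ℝ := (M * b ^ σ) ^ (1 / (τ - σ)) with hz₀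
  refine ⟨M * b ^ σ * z₀ ^ σ, fun θ hθ hne => ?_⟩
  have h0 : 0 < ‖θ‖ := norm_pos_iff.2 hne
  set z : ℝ := ρ / (Real.exp 1 * d * ‖θ‖) with hz
  have hz0 : 0 < z := by positivity
  have e : Real.pi / 2 / ‖θ‖ = b * z := by rw [hb, hz]; field_simp
  have h1 := xiNorm_rpow_neg_le hσ.le hθ hne
  rw [e, Real.mul_rpow hb0.le hz0.le] at h1
  have h2 : M * xiNorm θ ^ (-σ) ≤ M * b ^ σ * z ^ σ := by
    rw [mul_assoc]; exact mul_le_mul_of_nonneg_left h1 hM.le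
  refine h2.trans ?_
  have hτσ : 0 < τ - σ := by linarith
  rcases le_total z z₀ with h3 | h3
  · have h4 : z ^ σ ≤ z₀ ^ σ := Real.rpow_le_rpow hz0.le h3 hσ.le
    have h5 : 0 ≤ z ^ τ := by positivity
    have h6 : M * b ^ σ * z ^ σ ≤ M * b ^ σ * z₀ ^ σ := by gcongr
    linarith
  · have h4 : M * b ^ σ ≤ z ^ (τ - σ) := by
      calc M * b ^ σ = z₀ ^ (τ - σ) := by
            rw [hz₀, ← Real.rpow_mul (by positivity), one_div_mul_cancel hτσ.ne', Real.rpow_one]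
        _ ≤ _ := Real.rpow_le_rpow (by positivity) h3 hτσ.le
    have h5 : M * b ^ σ * z ^ σ ≤ z ^ τ := by
      calc M * b ^ σ * z ^ σ ≤ z ^ (τ - σ) * z ^ σ := by gcongr
        _ = z ^ τ := by rw [← Real.rpow_add hz0]; ring_nf
    have h6 : 0 ≤ z ^ τ := by positivity
    have h7 : 0 ≤ M * b ^ σ * z₀ ^ σ := by positivity
    linarith

/-! ### Comparison of `weightedEnergy` with the model weight `exp(c |ξ|^{-σ})` -/

theorem weightedEnergy_le {d : ℕ} (hd : 1 ≤ d) {p q : ℝ} (hq : q < 1) {a Θ Λ : ℝ → ℝ}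
    (hΛ : ∀ t : ℝ, 0 ≤ t → Λ t = (1 + t) ^ (1 - q)) {K N : ℝ} (hN : 2 * √d ≤ N)
    (hΘ : ∀ t : ℝ, 0 ≤ t → Θ t ≤ K * (1 + t) ^ (1 - p)) (F₀ F₁ : (Fin d → ℝ) → ℂ) :
    weightedEnergy a Θ Λ N F₀ F₁ ≤ ∫⁻ θ in cube d, ENNReal.ofReal
      (Real.exp (2 * K * N ^ ((1 - p) / (1 - q)) * xiNorm θ ^ (-((q - p) / (1 - q)))) *
        initialDensity a F₀ F₁ θ) := by
  refine lintegral_mono_ae ?_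
  filter_upwards [ae_xiNorm_pos hd] with θ hθ
  have hrN := (xiNorm_le θ).trans hN
  obtain ⟨h0, h1⟩ := invFunOn_spec hq hΛ hθ hrN
  refine ENNReal.ofReal_le_ofReal
    (mul_le_mul_of_nonneg_right (Real.exp_le_exp.2 ?_) (initialDensity_nonneg _ _ _ _))
  rw [mul_assoc (2 * K), ← mul_rpow_eq hq hθ (hθ.trans_le hrN) h0 h1]
  have := mul_le_mul_of_nonneg_left (hΘ _ h0) (by positivity : 0 ≤ 2 * xiNorm θ)
  linarith

theorem le_weightedEnergy {d : ℕ} (hd : 1 ≤ d) {p q : ℝ} (hq : q < 1) {a Θ Λ : ℝ → ℝ}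
    (hΛ : ∀ t : ℝ, 0 ≤ t → Λ t = (1 + t) ^ (1 - q)) {K N c : ℝ} (hN : 2 * √d ≤ N)
    (hΘ : ∀ t : ℝ, 0 ≤ t → K * (1 + t) ^ (1 - p) ≤ Θ t)
    (hc : c ≤ 2 * K * N ^ ((1 - p) / (1 - q))) (F₀ F₁ : (Fin d → ℝ) → ℂ) :
    ∫⁻ θ in cube d, ENNReal.ofReal
      (Real.exp (c * xiNorm θ ^ (-((q - p) / (1 - q)))) * initialDensity a F₀ F₁ θ) ≤
      weightedEnergy a Θ Λ N F₀ F₁ := by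
  refine lintegral_mono_ae ?_
  filter_upwards [ae_xiNorm_pos hd] with θ hθ
  have hrN := (xiNorm_le θ).trans hN
  obtain ⟨h0, h1⟩ := invFunOn_spec hq hΛ hθ hrN
  refine ENNReal.ofReal_le_ofReal
    (mul_le_mul_of_nonneg_right (Real.exp_le_exp.2 ?_) (initialDensity_nonneg _ _ _ _))
  refine (mul_le_mul_of_nonneg_right hc (by positivity)).trans ?_
  rw [mul_assoc (2 * K), ← mul_rpow_eq hq hθ (hθ.trans_le hrN) h0 h1]
  have := mul_le_mul_of_nonneg_left (hΘ _ h0) (by positivity : 0 ≤ 2 * xiNorm θ)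
  linarith

theorem ae_initialDensity_eq_zero {d : ℕ} (hd : 1 ≤ d) {q : ℝ} (hq : q < 1) {a Θ Λ : ℝ → ℝ}
    (hΛ : ∀ t : ℝ, 0 ≤ t → Λ t = (1 + t) ^ (1 - q)) {N : ℝ} (hN : 2 * √d ≤ N)
    (hΘ : ∀ t : ℝ, 0 ≤ t → 0 < Θ t) {u₀ u₁ : Ell2 d} {F₀ F₁ : (Fin d → ℝ) → ℂ}
    (hF₀ : IsDTFT u₀ F₀) (hF₁ : IsDTFT u₁ F₁) (h : weightedEnergy a Θ Λ N F₀ F₁ = 0) :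
    ∀ᵐ θ ∂(cubeMeasure d), initialDensity a F₀ F₁ θ = 0 := by
  have h1 : ∫⁻ θ in cube d, ENNReal.ofReal (initialDensity a F₀ F₁ θ) = 0 := by
    refine le_antisymm (le_trans (lintegral_mono_ae ?_) h.le) zero_le
    filter_upwards [ae_xiNorm_pos hd] with θ hθ
    obtain ⟨h0, -⟩ := invFunOn_spec hq hΛ hθ ((xiNorm_le θ).trans hN)
    have hpos := hΘ _ h0
    refine ENNReal.ofReal_le_ofReal (le_mul_of_one_le_left (initialDensity_nonneg _ _ _ _) ?_)
    exact Real.one_le_exp (by positivity)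
  have hm : AEMeasurable (fun θ => ENNReal.ofReal (initialDensity a F₀ F₁ θ)) (cubeMeasure d) := by
    refine AEMeasurable.ennreal_ofReal ?_
    exact (hF₁.1.1.norm.aemeasurable.pow_const 2).add
      (((continuous_xiNorm.measurable.pow_const 2).const_mul (a 0 ^ 2)).aemeasurable.mul
        (hF₀.1.1.norm.aemeasurable.pow_const 2))
  rw [lintegral_eq_zero_iff' hm] at h1
  filter_upwards [h1] with θ hθ
  exact le_antisymm (ENNReal.ofReal_eq_zero.1 hθ) (initialDensity_nonneg _ _ _ _)

/-- With no lower bound on `Θ` the two weights cannot be compared, but for fixed data both integrals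
are finite and their ratio is an admissible constant. If `U` vanishes, then so does the initial
density almost everywhere, because the weight in `U` is at least `1`. -/
theorem exists_const_mul_weightedEnergy {d : ℕ} (hd : 1 ≤ d) {q : ℝ} (hq : q < 1)
    {a Θ Λ : ℝ → ℝ} (hΛ : ∀ t : ℝ, 0 ≤ t → Λ t = (1 + t) ^ (1 - q)) {N : ℝ} (hN : 2 * √d ≤ N)
    (hΘ : ∀ t : ℝ, 0 ≤ t → 0 < Θ t) {u₀ u₁ : Ell2 d} {F₀ F₁ : (Fin d → ℝ) → ℂ}
    (hF₀ : IsDTFT u₀ F₀) (hF₁ : IsDTFT u₁ F₁) (hU : weightedEnergy a Θ Λ N F₀ F₁ < ⊤)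
    {w : (Fin d → ℝ) → ℝ} (hw : ∫⁻ θ in cube d, ENNReal.ofReal
      (w θ * initialDensity a F₀ F₁ θ) < ⊤) {C : ℝ} {f : ℝ → ℝ≥0∞}
    (hf : ∀ t, 0 ≤ t → f t ≤ ENNReal.ofReal C * ∫⁻ θ in cube d, ENNReal.ofReal
      (w θ * initialDensity a F₀ F₁ θ)) :
    ∃ C' : ℝ, 0 < C' ∧ ∀ t : ℝ, 0 ≤ t →
      f t ≤ ENNReal.ofReal C' * weightedEnergy a Θ Λ N F₀ F₁ := by
  set U := weightedEnergy a Θ Λ N F₀ F₁ with hUdef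
  set X := ∫⁻ θ in cube d, ENNReal.ofReal (w θ * initialDensity a F₀ F₁ θ) with hX
  rcases eq_or_ne U 0 with h0 | h0
  · refine ⟨1, one_pos, fun t ht => (hf t ht).trans ?_⟩
    have hX0 : X = 0 := by
      rw [hX, ← lintegral_zero (μ := volume.restrict (cube d))]
      refine lintegral_congr_ae ?_
      filter_upwards [ae_initialDensity_eq_zero hd hq hΛ hN hΘ hF₀ hF₁ h0] with θ hθ
      rw [hθ, mul_zero, ENNReal.ofReal_zero]
    rw [hX0, mul_zero]
    exact zero_le
  · have hne : ENNReal.ofReal C * X / U ≠ ⊤ :=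
      ENNReal.div_ne_top (ENNReal.mul_ne_top ENNReal.ofReal_ne_top hw.ne) h0
    refine ⟨(ENNReal.ofReal C * X / U).toReal + 1, by positivity, fun t ht => (hf t ht).trans ?_⟩
    calc ENNReal.ofReal C * X = ENNReal.ofReal C * X / U * U :=
          (ENNReal.div_mul_cancel h0 hU.ne).symm
      _ = ENNReal.ofReal (ENNReal.ofReal C * X / U).toReal * U := by
          rw [ENNReal.ofReal_toReal hne]
      _ ≤ _ := by gcongr; linarith

theorem exists_frequency_threshold {d : ℕ} {κ K c : ℝ} (hκ : 0 < κ) (hK : 0 < K) (hc : 0 < c) :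
    ∃ N : ℝ, 2 * √d ≤ N ∧ c ≤ 2 * K * N ^ κ := by
  refine ⟨max (2 * √d) ((c / (2 * K)) ^ (1 / κ)), le_max_left _ _, ?_⟩
  calc c = 2 * K * ((c / (2 * K)) ^ (1 / κ)) ^ κ := by
        rw [← Real.rpow_mul (by positivity), one_div_mul_cancel hκ.ne', Real.rpow_one]
        field_simp
    _ ≤ _ := by
        gcongr
        exact le_max_right _ _

end SemiDiscreteWave

end

theorem mainTheorem4 (d : ℕ) (hd : 1 ≤ d) (m : ℕ) (hm : 1 ≤ m) (p q : ℝ)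
    (hp : 0 ≤ p) (hpq : p < q) (hq : q < 1) (a Θ Ξ Λ : ℝ → ℝ)
    (ha : SemiDiscreteWave.BoundedSpeed a)
    (hΘ_pos : ∀ t : ℝ, 0 ≤ t → 0 < Θ t)
    (hΘ_mono : MonotoneOn Θ (Ici 0))
    (hΘ_le : ∃ K : ℝ, 0 < K ∧ ∀ t : ℝ, 0 ≤ t → Θ t ≤ K * (1 + t) ^ (1 - p))
    (hΞ : ∀ t : ℝ, 0 ≤ t → Ξ t = (1 + t) ^ (p / m - q + 1))
    (hΛ : ∀ t : ℝ, 0 ≤ t → Λ t = (1 + t) ^ (1 - q))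
    (h1 : SemiDiscreteWave.Stabilizes a Θ)
    (h2 : SemiDiscreteWave.OscillationBound a Ξ m)
    (hΞ_int : IntegrableOn (fun t => (Ξ t ^ m)⁻¹) (Ici 0)) :
    -- (i) subcritical Gevrey order
    (∀ ν : ℝ, 1 < ν → ν < (1 - p) / (q - p) →
      ∀ (u₀ u₁ : SemiDiscreteWave.Ell2 d) (F₀ F₁ : (Fin d → ℝ) → ℂ),
      SemiDiscreteWave.VanishingDataIn (SemiDiscreteWave.gevreyClassInfty d ν) u₀ u₁ F₀ F₁ →
      ∃ N₀ : ℝ, 2 * √d ≤ N₀ ∧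
        SemiDiscreteWave.weightedEnergy a Θ Λ N₀ F₀ F₁ < ⊤ ∧
        ∀ u u' : ℝ → SemiDiscreteWave.Ell2 d, SemiDiscreteWave.IsSolution a u₀ u₁ u u' →
          ∃ C : ℝ, 0 < C ∧ ∀ t : ℝ, 0 ≤ t → SemiDiscreteWave.energy a u u' t ≤
            ENNReal.ofReal C * SemiDiscreteWave.weightedEnergy a Θ Λ N₀ F₀ F₁) ∧
    -- (ii) critical Gevrey order
    (∃ ρ N₀ : ℝ, 0 < ρ ∧ 2 * √d ≤ N₀ ∧
      ∀ (u₀ u₁ : SemiDiscreteWave.Ell2 d) (F₀ F₁ : (Fin d → ℝ) → ℂ),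
      SemiDiscreteWave.VanishingDataIn
        (SemiDiscreteWave.gevreyClass d ((1 - p) / (q - p)) ρ) u₀ u₁ F₀ F₁ →
        SemiDiscreteWave.weightedEnergy a Θ Λ N₀ F₀ F₁ < ⊤ ∧
        ∀ u u' : ℝ → SemiDiscreteWave.Ell2 d, SemiDiscreteWave.IsSolution a u₀ u₁ u u' →
          ∃ C : ℝ, 0 < C ∧ ∀ t : ℝ, 0 ≤ t → SemiDiscreteWave.energy a u u' t ≤
            ENNReal.ofReal C * SemiDiscreteWave.weightedEnergy a Θ Λ N₀ F₀ F₁) ∧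
    -- uniformity: if `Θ` is comparable to `(1 + t) ^ (1 - p)`, then the constants of the energy
    -- estimates in (i) and (ii) do not depend on the data
    ((∃ c : ℝ, 0 < c ∧ ∀ t : ℝ, 0 ≤ t → c * (1 + t) ^ (1 - p) ≤ Θ t) →
      (∃ N₀ C : ℝ, 2 * √d ≤ N₀ ∧ 0 < C ∧
        ∀ ν : ℝ, 1 < ν → ν < (1 - p) / (q - p) →
        ∀ (u₀ u₁ : SemiDiscreteWave.Ell2 d) (F₀ F₁ : (Fin d → ℝ) → ℂ),
        SemiDiscreteWave.VanishingDataIn (SemiDiscreteWave.gevreyClassInfty d ν) u₀ u₁ F₀ F₁ →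
          SemiDiscreteWave.weightedEnergy a Θ Λ N₀ F₀ F₁ < ⊤ ∧
          ∀ u u' : ℝ → SemiDiscreteWave.Ell2 d, SemiDiscreteWave.IsSolution a u₀ u₁ u u' →
            ∀ t : ℝ, 0 ≤ t → SemiDiscreteWave.energy a u u' t ≤
              ENNReal.ofReal C * SemiDiscreteWave.weightedEnergy a Θ Λ N₀ F₀ F₁) ∧
      (∃ ρ N₀ C : ℝ, 0 < ρ ∧ 2 * √d ≤ N₀ ∧ 0 < C ∧
        ∀ (u₀ u₁ : SemiDiscreteWave.Ell2 d) (F₀ F₁ : (Fin d → ℝ) → ℂ),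
        SemiDiscreteWave.VanishingDataIn
          (SemiDiscreteWave.gevreyClass d ((1 - p) / (q - p)) ρ) u₀ u₁ F₀ F₁ →
          SemiDiscreteWave.weightedEnergy a Θ Λ N₀ F₀ F₁ < ⊤ ∧
          ∀ u u' : ℝ → SemiDiscreteWave.Ell2 d, SemiDiscreteWave.IsSolution a u₀ u₁ u u' →
            ∀ t : ℝ, 0 ≤ t → SemiDiscreteWave.energy a u u' t ≤
              ENNReal.ofReal C * SemiDiscreteWave.weightedEnergy a Θ Λ N₀ F₀ F₁)) := by
  have hpm := SemiDiscreteWave.one_lt_of_integrableOn hm hΞ hΞ_int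
  obtain ⟨C, c, hC, hc, hE⟩ :=
    SemiDiscreteWave.energy_le_weighted hd hm hp hpq hq ha hΘ_le hΞ h1 h2 hpm
  obtain ⟨K, hK, hΘK⟩ := hΘ_le
  set σ : ℝ := (q - p) / (1 - q) with hσdef
  set κ : ℝ := (1 - p) / (1 - q) with hκdef
  have hqp : 0 < q - p := by linarith
  have hq0 : 0 < 1 - q := by linarith
  have hσ : 0 < σ := div_pos hqp hq0
  have hκ : 0 < κ := div_pos (by linarith) hq0
  have hd0 : (0 : ℝ) < d := by exact_mod_cast hd
  have hsqrt : 0 < √(d : ℝ) := Real.sqrt_pos.2 hd0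
  -- At the critical order the flatness exponent `1/(ν - 1)` is exactly `σ`.
  have hcrit : ((1 - p) / (q - p) - 1) * σ = 1 := by
    rw [hσdef]; field_simp; ring
  have hfin_sub : ∀ M : ℝ, 0 < M → ∀ ν : ℝ, 1 < ν → ν < (1 - p) / (q - p) →
      ∀ (u₀ u₁ : SemiDiscreteWave.Ell2 d) (F₀ F₁ : (Fin d → ℝ) → ℂ),
      SemiDiscreteWave.VanishingDataIn (SemiDiscreteWave.gevreyClassInfty d ν) u₀ u₁ F₀ F₁ →
      ∫⁻ θ in SemiDiscreteWave.cube d, ENNReal.ofReal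
        (Real.exp (M * SemiDiscreteWave.xiNorm θ ^ (-σ)) *
          SemiDiscreteWave.initialDensity a F₀ F₁ θ) < ⊤ := by
    intro M hM ν hν1 hν u₀ u₁ F₀ F₁ hdata
    obtain ⟨ρ, hρ, hdata'⟩ := hdata.exists_radius hd
    have hν0 : 0 < ν - 1 := by linarith
    have hστ : σ < 1 / (ν - 1) := by
      rw [lt_div_iff₀ hν0]
      calc σ * (ν - 1) < σ * ((1 - p) / (q - p) - 1) := by
            apply mul_lt_mul_of_pos_left _ hσ
            linarith
        _ = 1 := by rw [mul_comm, hcrit]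
    obtain ⟨C', hC'⟩ := SemiDiscreteWave.subcritical_weight_le hd hσ hστ hM hρ
    exact hdata'.lintegral_exp_lt_top hd hρ (by positivity) (mul_one_div_cancel hν0.ne') a hC'
  have hfin_crit : ∀ M M' : ℝ, 0 < M' → M ≤ M' →
      ∀ (u₀ u₁ : SemiDiscreteWave.Ell2 d) (F₀ F₁ : (Fin d → ℝ) → ℂ),
      SemiDiscreteWave.VanishingDataIn (SemiDiscreteWave.gevreyClass d ((1 - p) / (q - p))
        (Real.exp 1 * d * (Real.pi / 2) * M' ^ (1 / σ))) u₀ u₁ F₀ F₁ →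
      ∫⁻ θ in SemiDiscreteWave.cube d, ENNReal.ofReal
        (Real.exp (M * SemiDiscreteWave.xiNorm θ ^ (-σ)) *
          SemiDiscreteWave.initialDensity a F₀ F₁ θ) < ⊤ := by
    intro M M' hM' hMM u₀ u₁ F₀ F₁ hdata
    have hπ := Real.pi_pos
    exact hdata.lintegral_exp_lt_top hd (by positivity) hσ hcrit a fun θ hθ hne =>
      (mul_le_mul_of_nonneg_right hMM
        (Real.rpow_nonneg (SemiDiscreteWave.xiNorm_nonneg θ) _)).trans
        (SemiDiscreteWave.critical_weight_le hd hσ hM' hθ hne)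
  have hU : ∀ N : ℝ, 2 * √d ≤ N → 0 < 2 * K * N ^ κ := fun N hN => by
    have : 0 < N := lt_of_lt_of_le (by positivity) hN
    positivity
  have hUle := fun (N : ℝ) (hN : 2 * √d ≤ N) (F₀ F₁ : (Fin d → ℝ) → ℂ) =>
    SemiDiscreteWave.weightedEnergy_le (a := a) hd hq hΛ hN hΘK F₀ F₁
  refine ⟨?_, ?_, ?_⟩
  · intro ν hν1 hν u₀ u₁ F₀ F₁ hdata
    have hUfin := (hUle _ le_rfl F₀ F₁).trans_lt
      (hfin_sub _ (hU _ le_rfl) ν hν1 hν u₀ u₁ F₀ F₁ hdata)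
    -- The constant may depend on the data here, so the smallest admissible `N₀` is enough.
    exact ⟨2 * √d, le_rfl, hUfin, fun u u' hu =>
      SemiDiscreteWave.exists_const_mul_weightedEnergy hd hq hΛ le_rfl hΘ_pos hdata.dtft_fst
        hdata.dtft_snd hUfin (hfin_sub c hc ν hν1 hν u₀ u₁ F₀ F₁ hdata)
        (hE u₀ u₁ F₀ F₁ hdata.dtft_fst hdata.dtft_snd u u' hu)⟩
  · have hM := hU _ le_rfl
    -- One radius has to beat two weights: the one bounding `U`, with coefficient `2 K (2√d)^κ`, and
    -- the one in the energy estimate, with coefficient `c`. The sum dominates both.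
    have hM' : 0 < 2 * K * (2 * √d) ^ κ + c := by linarith
    have hπ := Real.pi_pos
    refine ⟨Real.exp 1 * d * (Real.pi / 2) * (2 * K * (2 * √d) ^ κ + c) ^ (1 / σ), 2 * √d,
      by positivity, le_rfl, ?_⟩
    intro u₀ u₁ F₀ F₁ hdata
    have hUfin := (hUle _ le_rfl F₀ F₁).trans_lt
      (hfin_crit _ _ hM' (by linarith) u₀ u₁ F₀ F₁ hdata)
    exact ⟨hUfin, fun u u' hu =>
      SemiDiscreteWave.exists_const_mul_weightedEnergy hd hq hΛ le_rfl hΘ_pos hdata.dtft_fst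
        hdata.dtft_snd hUfin (hfin_crit c _ hM' (by linarith) u₀ u₁ F₀ F₁ hdata)
        (hE u₀ u₁ F₀ F₁ hdata.dtft_fst hdata.dtft_snd u u' hu)⟩
  · rintro ⟨c₀, hc₀, hΘc⟩
    -- With `2 c₀ N^κ ≥ c` the weight in `U` dominates `exp(c |ξ|^{-σ})` pointwise, so `C` comes
    -- directly from `energy_le_weighted` and the radius has only to ensure that `U` is finite.
    obtain ⟨N, hN, hcN⟩ := SemiDiscreteWave.exists_frequency_threshold (d := d) hκ hc₀ hc
    have hest : ∀ (u₀ u₁ : SemiDiscreteWave.Ell2 d) (F₀ F₁ : (Fin d → ℝ) → ℂ),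
        SemiDiscreteWave.IsDTFT u₀ F₀ → SemiDiscreteWave.IsDTFT u₁ F₁ →
        ∀ u u' : ℝ → SemiDiscreteWave.Ell2 d, SemiDiscreteWave.IsSolution a u₀ u₁ u u' →
        ∀ t : ℝ, 0 ≤ t → SemiDiscreteWave.energy a u u' t ≤
          ENNReal.ofReal C * SemiDiscreteWave.weightedEnergy a Θ Λ N F₀ F₁ :=
      fun u₀ u₁ F₀ F₁ hF₀ hF₁ u u' hu t ht => (hE u₀ u₁ F₀ F₁ hF₀ hF₁ u u' hu t ht).trans
        (mul_le_mul_right (SemiDiscreteWave.le_weightedEnergy hd hq hΛ hN hΘc hcN F₀ F₁) _)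
    have hπ := Real.pi_pos
    have hM := hU N hN
    refine ⟨⟨N, C, hN, hC, fun ν hν1 hν u₀ u₁ F₀ F₁ hdata => ⟨?_, ?_⟩⟩,
      Real.exp 1 * d * (Real.pi / 2) * (2 * K * N ^ κ) ^ (1 / σ), N, C, by positivity, hN, hC,
      fun u₀ u₁ F₀ F₁ hdata => ⟨?_, ?_⟩⟩
    · exact (hUle N hN F₀ F₁).trans_lt (hfin_sub _ hM ν hν1 hν u₀ u₁ F₀ F₁ hdata)
    · exact hest u₀ u₁ F₀ F₁ hdata.dtft_fst hdata.dtft_snd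
    · exact (hUle N hN F₀ F₁).trans_lt (hfin_crit _ _ hM le_rfl u₀ u₁ F₀ F₁ hdata)
    · exact hest u₀ u₁ F₀ F₁ hdata.dtft_fst hdata.dtft_snd
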